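/- Consider the problem $$\min_{x\in Q_x}\max_{y\in Q_y}\{r(x)+F(x,y)\},$$ where $Q_x\subseteq\mathbb R^n$ is closed and convex; $Q_y\subset\mathbb R^m$ ($m\ge 1$) is convex and compact, is contained in a given closed Euclidean ball of centre $c$ and radius $\mathcal R>0$ and contains a closed Euclidean ball of radius $\rho>0$; $r$ is continuous and $\mu_x$-strongly convex on $Q_x$ ($\mu_x>0$); $F$, given in a neighbourhood of $Q_x\times Q_y$, is convex in $x$, $\mu_y$-strongly concave in $y$ ($\mu_y>0$), differentiable in $x$ and in $y$ at the points of $Q_x\times Q_y$, and for all $x,x'\in Q_x$, $y,y'\in Q_y$, with constants $L_{xx},L_{xy}\ge 0$ and $B>0$, $$\|\nabla_xF(x,y)-\nabla_xF(x',y)\|\le L_{xx}\|x-x'\|,\quad \|\nabla_xF(x,y)-\nabla_xF(x,y')\|\le L_{xy}\|y-y'\|,$$ $$\|\nabla_yF(x,y)-\nabla_yF(x',y)\|\le L_{xy}\|x-x'\|,\quad F(x,y)-F(x,y')\le B.$$ Let $s(x)=\max_{y\in Q_y}F(x,y)$, let $x_*$ minimize $f=r+s$ over $Q_x$, let $x^0\in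 Q_x$ and $R>0$ with $\|x^0-x_*\|\le R$, and let $L=L_{xx}+2L_{xy}^2/\mu_y$, assumed positive. The norms are Euclidean. The method with parameters $N,K\in\mathbb N$ is as follows. *Outer method (fast gradient method with an inexact model, model constant $2L$).* Start with $y^0=u^0=x^0$, $A_0=0$. For $k=0,\dots,N-1$: let $\alpha_{k+1}$ be the largest root of $(A_k+\alpha)(1+A_k\mu_x)=2L\alpha^2$, $A_{k+1}=A_k+\alpha_{k+1}$, $z^{k+1}=(\alpha_{k+1}u^k+A_ky^k)/A_{k+1}$; find $\tilde y\in Q_y$ by the inner method applied to $g=-F(z^{k+1},\cdot)$; put $\psi(x)=r(x)-r(z^{k+1})+\langle\nabla_xF(z^{k+1},\tilde y),x-z^{k+1}\rangle$, $$u^{k+1}=\operatorname*{arg\,min}_{x\in Q_x}\Big\{\tfrac{1+A_k\mu_x}{2}\|x-u^k\|^2+\alpha_{k+1}\psi(x)\Big\},\qquad y^{k+1}=\frac{\alpha_{k+1}u^{k+1}+A_ky^k}{A_{k+1}}.$$ Return $\tilde x=y^N$. The minimization defining $u^{k+1}$ is one prox step, i.e. one solution of a problem $\min_{x\in Q_x}\{\langle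 c_1,x\rangle+r(x)+c_2\|x\|^2\}$ with $c_2>0$. *Inner method (ellipsoid method, $K$ iterations).* Start with $c_0=c$, $H_0=\mathcal R^2I_m$. At step $k<K$: if $c_k\in Q_y$, compute a subgradient $w_k$ of $g$ on $Q_y$ at $c_k$ and, if $w_k=0$, return $c_k$; if $c_k\notin Q_y$, take $w_k\ne0$ with $\langle w_k,y-c_k\rangle\le0$ for all $y\in Q_y$ such that $(y-c_k)^TH_k^{-1}(y-c_k)\le 1$. Put $$c_{k+1}=c_k-\tfrac1{m+1}\tfrac{H_kw_k}{\sqrt{w_k^TH_kw_k}},\qquad H_{k+1}=\tfrac{m^2}{m^2-1}\Big(H_k-\tfrac2{m+1}\tfrac{H_kw_kw_k^TH_k}{w_k^TH_kw_k}\Big)$$ ($H_{k+1}=H_k/4$ if $m=1$). After $K$ steps return a point of $\{c_0,\dots,c_K\}\cap Q_y$ with the smallest value of $g$. Each subgradient is counted as one computation of $\partial_yF$ and each update of $(c_k,H_k)$ as one MatVec$(m)$ (a product of an $m\times m$ matrix with a vector). **Theorem.** There is an absolute constant $C>0$ such that for all parameters $m,L_{xx},L_{xy},\mu_x,\mu_y,B,\mathcal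 R,\rho,R$ as above there is $\varepsilon_0>0$, depending only on these parameters, with the following property. For every $\varepsilon>0$ there are $N$ and $K$, depending only on the parameters and $\varepsilon$, such that for every $n$ and every problem and starting point with these parameters the method with $N$ and $K$ can be carried out to the end, and, whatever subgradients, separating vectors and minimizing centres it picks, it returns $\tilde x\in Q_x$ with $\|\tilde x-x_*\|\le\varepsilon$, using at most $$C\sqrt{\max\{1,L/\mu_x\}}\;\max\Big\{1,\ln\frac{LR^2}{\mu_x\varepsilon^2}\Big\}$$ computations of $\nabla_xF$ and at most as many prox steps, and, if $\varepsilon\le\varepsilon_0$, at most $$C\,m^2\sqrt{\max\{1,L/\mu_x\}}\;\ln\Big(\frac{LR^2}{\mu_x\varepsilon^2}\Big)\ln\Big(\frac{B\mathcal R}{\rho\varepsilon}\Big)$$ computations of $\partial_yF$ and at most as many MatVec$(m)$ operations. -/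

import Mathlib

open Set

noncomputable section

/-- The Euclidean space `ℝᵈ`. -/
abbrev Euc (d : ℕ) : Type := EuclideanSpace ℝ (Fin d)

/-- Numbers of elementary operations: evaluations of `∇ₓF`, solutions of the proximal problem
`min_{x ∈ Q_x} ⟨c₁, x⟩ + r x + c₂ ‖x‖²`, evaluations of (an element of) `∂_yF`, and products of an
`m × m` matrix with a vector. -/
structure OpCount where
  gradX : ℕ
  prox : ℕ
  subgradY : ℕ
  matVec : ℕ

/-! ### The ellipsoid method with `δ`-subgradients -/

/-- The set of `δ`-subgradients at `p` of a function `g` on `Q`. -/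
def deltaSubdiff {m : ℕ} (δ : ℝ) (Q : Set (Euc m)) (g : Euc m → ℝ) (p : Euc m) : Set (Euc m) :=
  {w | ∀ x ∈ Q, g p + inner ℝ w (x - p) - δ ≤ g x}

/-- The product of a matrix with a vector of `ℝᵐ`. -/
def mulE {m : ℕ} (H : Matrix (Fin m) (Fin m) ℝ) (w : Euc m) : Euc m :=
  WithLp.toLp 2 (H.mulVec w.ofLp)

/-- The ellipsoid `{x : (x - c)ᵀ H⁻¹ (x - c) ≤ 1}`. -/
def ellipsoidSet {m : ℕ} (c : Euc m) (H : Matrix (Fin m) (Fin m) ℝ) : Set (Euc m) :=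
  {x | inner ℝ (x - c) (mulE H⁻¹ (x - c)) ≤ 1}

/-- The next centre `c - (1 / (m + 1)) H w / √(wᵀ H w)`. -/
def nextCenter {m : ℕ} (c : Euc m) (H : Matrix (Fin m) (Fin m) ℝ) (w : Euc m) : Euc m :=
  c - ((1 / ((m : ℝ) + 1)) * (1 / Real.sqrt (inner ℝ w (mulE H w)))) • mulE H w

/-- The next matrix `(m² / (m² - 1)) (H - (2 / (m + 1)) H w wᵀ H / (wᵀ H w))`. For `m = 1`, where
this expression reads `0 / 0`, it is `H / 4`: the smallest ellipsoid (an interval) containing the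
half of the current one that is kept, exactly as the formula gives for `m ≥ 2`. -/
def nextMatrix {m : ℕ} (H : Matrix (Fin m) (Fin m) ℝ) (w : Euc m) : Matrix (Fin m) (Fin m) ℝ :=
  if m = 1 then (1 / 4 : ℝ) • H
  else ((m : ℝ) ^ 2 / ((m : ℝ) ^ 2 - 1)) •
    (H - ((2 / ((m : ℝ) + 1)) * (1 / inner ℝ w (mulE H w))) •
      Matrix.vecMulVec (H.mulVec w.ofLp) (Matrix.vecMul w.ofLp H))

/-- `EllipsoidRun δ Q g K V c H out s t`: the ellipsoid method with `δ`-subgradients for minimizing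
`g` over `Q`, with `K` iterations left, current centre `c`, current matrix `H` and set `V` of the
centres met so far (`c` included), can return `out`, performing on the way `s` computations of a
`δ`-subgradient and `t` products of a matrix with a vector. -/
inductive EllipsoidRun {m : ℕ} (δ : ℝ) (Q : Set (Euc m)) (g : Euc m → ℝ) :
    ℕ → Set (Euc m) → Euc m → Matrix (Fin m) (Fin m) ℝ → Euc m → ℕ → ℕ → Prop
  /-- No iteration is left: return a centre in `Q` with the smallest value of `g`. -/
  | finish {V : Set (Euc m)} {c out : Euc m} {H : Matrix (Fin m) (Fin m) ℝ}
      (hout : out ∈ V ∩ Q) (hmin : IsMinOn g (V ∩ Q) out) :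
      EllipsoidRun δ Q g 0 V c H out 0 0
  /-- The centre lies in `Q` and the computed `δ`-subgradient is zero: return the centre. -/
  | stationary {K : ℕ} {V : Set (Euc m)} {c : Euc m} {H : Matrix (Fin m) (Fin m) ℝ}
      (hc : c ∈ Q) (hw : 0 ∈ deltaSubdiff δ Q g c) :
      EllipsoidRun δ Q g (K + 1) V c H c 1 0
  /-- The centre lies in `Q`: cut with a non-zero `δ`-subgradient. -/
  | inside {K s t : ℕ} {V : Set (Euc m)} {c w out : Euc m} {H : Matrix (Fin m) (Fin m) ℝ}
      (hc : c ∈ Q) (hw : w ∈ deltaSubdiff δ Q g c) (hw0 : w ≠ 0)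
      (next : EllipsoidRun δ Q g K (insert (nextCenter c H w) V)
        (nextCenter c H w) (nextMatrix H w) out s t) :
      EllipsoidRun δ Q g (K + 1) V c H out (s + 1) (t + 1)
  /-- The centre lies outside `Q`: cut with a separating hyperplane through the centre. -/
  | outside {K s t : ℕ} {V : Set (Euc m)} {c w out : Euc m} {H : Matrix (Fin m) (Fin m) ℝ}
      (hc : c ∉ Q) (hw0 : w ≠ 0)
      (hw : ∀ x ∈ Q ∩ ellipsoidSet c H, inner ℝ w (x - c) ≤ 0)
      (next : EllipsoidRun δ Q g K (insert (nextCenter c H w) V)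
        (nextCenter c H w) (nextMatrix H w) out s t) :
      EllipsoidRun δ Q g (K + 1) V c H out s (t + 1)

/-- The ellipsoid method with `K` iterations, started from the ball with centre `c` and
radius `ℛ`. -/
def EllipsoidMethod {m : ℕ} (δ : ℝ) (Q : Set (Euc m)) (g : Euc m → ℝ) (K : ℕ) (c : Euc m) (ℛ : ℝ)
    (out : Euc m) (s t : ℕ) : Prop :=
  EllipsoidRun δ Q g K {c} c ((ℛ ^ 2) • (1 : Matrix (Fin m) (Fin m) ℝ)) out s t

/-! ### The fast gradient method with an inexact model -/

/-- The function `φ(x) = ((1 + A μ) / 2) ‖x - u‖² + α ψ(x)` minimized in one step of the fast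
gradient method. -/
def fgmPhi {n : ℕ} (μ A α : ℝ) (u : Euc n) (ψ : Euc n → ℝ) (x : Euc n) : ℝ :=
  (1 + A * μ) / 2 * ‖x - u‖ ^ 2 + α * ψ x

/-- `FGMRun Q L μ oracle N y u A out k`: the fast gradient method on `Q` with parameters `L` and `μ`
for the model oracle `oracle`, with `N` iterations left and current `y`, `u`, `A`, can return `out`,
performing the operations counted by `k` on the way. Here `oracle z ψ k` says that the oracle, asked
at the point `z`, can answer with the model function `ψ = ψ(·, z)` at the cost `k`. Each iteration
asks the oracle once and minimizes `fgmPhi` once. -/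
inductive FGMRun {n : ℕ} (Q : Set (Euc n)) (L μ : ℝ)
    (oracle : Euc n → (Euc n → ℝ) → OpCount → Prop) :
    ℕ → Euc n → Euc n → ℝ → Euc n → OpCount → Prop
  | finish {y u : Euc n} {A : ℝ} : FGMRun Q L μ oracle 0 y u A y ⟨0, 0, 0, 0⟩
  | step {N : ℕ} {y u z u' y' out : Euc n} {A α : ℝ} {ψ : Euc n → ℝ} {k₁ k₂ : OpCount}
      (hα : IsGreatest {a : ℝ | (A + a) * (1 + A * μ) = L * a ^ 2} α)
      (hz : z = (A + α)⁻¹ • (α • u + A • y))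
      (hψ : oracle z ψ k₁)
      (hu : u' ∈ Q) (hmin : IsMinOn (fgmPhi μ A α u ψ) Q u')
      (hy : y' = (A + α)⁻¹ • (α • u' + A • y))
      (next : FGMRun Q L μ oracle N y' u' (A + α) out k₂) :
      FGMRun Q L μ oracle (N + 1) y u A out
        ⟨k₁.gradX + k₂.gradX, k₁.prox + 1 + k₂.prox, k₁.subgradY + k₂.subgradY,
          k₁.matVec + k₂.matVec⟩

/-! ### The saddle-point problem -/

/-- `s(x) = max_{y ∈ Q_y} F(x, y)`. -/
def innerMax {n m : ℕ} (Qy : Set (Euc m)) (F : Euc n → Euc m → ℝ) (x : Euc n) : ℝ :=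
  sSup (F x '' Qy)

/-- `f(x) = r(x) + s(x)`. -/
def outerObj {n m : ℕ} (Qy : Set (Euc m)) (r : Euc n → ℝ) (F : Euc n → Euc m → ℝ) (x : Euc n) : ℝ :=
  r x + innerMax Qy F x

/-- `L = L_xx + 2 L_xy² / μ_y`. -/
def effL (Lxx Lxy μy : ℝ) : ℝ := Lxx + 2 * Lxy ^ 2 / μy

/-- The standing assumptions on the problem `min_{x ∈ Q_x} max_{y ∈ Q_y} r(x) + F(x, y)`. The
function `F` matters only near `Q_x × Q_y`; its values elsewhere are arbitrary. -/
structure IsSaddleProblem {n m : ℕ} (Qx : Set (Euc n)) (Qy : Set (Euc m)) (r : Euc n → ℝ)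
    (F : Euc n → Euc m → ℝ) (c : Euc m) (Lxx Lxy μx μy B ℛ ρ : ℝ) : Prop where
  convex_Qx : Convex ℝ Qx
  closed_Qx : IsClosed Qx
  convex_Qy : Convex ℝ Qy
  compact_Qy : IsCompact Qy
  subset_ball : Qy ⊆ Metric.closedBall c ℛ
  ball_subset : ∃ p, Metric.closedBall p ρ ⊆ Qy
  continuous_r : ContinuousOn r Qx
  strongConvex_r : StrongConvexOn Qx μx r
  convex_F : ∀ y ∈ Qy, ConvexOn ℝ Qx (fun x => F x y)
  strongConcave_F : ∀ x ∈ Qx, StrongConcaveOn Qy μy (F x)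
  diff_x : ∀ x ∈ Qx, ∀ y ∈ Qy, DifferentiableAt ℝ (fun x' => F x' y) x
  diff_y : ∀ x ∈ Qx, ∀ y ∈ Qy, DifferentiableAt ℝ (F x) y
  lip_xx : ∀ x ∈ Qx, ∀ x' ∈ Qx, ∀ y ∈ Qy,
    ‖gradient (fun p => F p y) x - gradient (fun p => F p y) x'‖ ≤ Lxx * ‖x - x'‖
  lip_xy : ∀ x ∈ Qx, ∀ y ∈ Qy, ∀ y' ∈ Qy,
    ‖gradient (fun p => F p y) x - gradient (fun p => F p y') x‖ ≤ Lxy * ‖y - y'‖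
  lip_yx : ∀ x ∈ Qx, ∀ x' ∈ Qx, ∀ y ∈ Qy,
    ‖gradient (F x) y - gradient (F x') y‖ ≤ Lxy * ‖x - x'‖
  bounded : ∀ x ∈ Qx, ∀ y ∈ Qy, ∀ y' ∈ Qy, F x y - F x y' ≤ B

/-! ### The combined method -/

/-- The model oracle: at `z` it runs `K` iterations of the ellipsoid method (with `δ = 0`) for
`-F(z, ·)` on `Q_y`, which gives `y`, computes `∇ₓF(z, y)` once, and returns the model function
`x ↦ r(x) - r(z) + ⟨∇ₓF(z, y), x - z⟩`. -/
def innerOracle {n m : ℕ} (Qy : Set (Euc m)) (r : Euc n → ℝ) (F : Euc n → Euc m → ℝ)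
    (c : Euc m) (ℛ : ℝ) (K : ℕ) (z : Euc n) (ψ : Euc n → ℝ) (k : OpCount) : Prop :=
  ∃ (y : Euc m) (s t : ℕ),
    EllipsoidMethod 0 Qy (fun q => -F z q) K c ℛ y s t ∧
    ψ = (fun x => r x - r z + inner ℝ (gradient (fun p => F p y) z) (x - z)) ∧
    k = ⟨1, 0, s, t⟩

/-- With the model function of `innerOracle`, the function minimized in one step of the fast
gradient method is, up to a positive factor and an additive constant, the objective
`⟨c₁, x⟩ + r(x) + c₂ ‖x‖²` of the proximal problem, with `c₂ > 0`: that step is one solution of the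
proximal problem. -/
theorem fgmPhi_eq_prox {n : ℕ} (r : Euc n → ℝ) (z u g : Euc n) (μ A α : ℝ) (hμ : 0 < μ)
    (hA : 0 ≤ A) (hα : 0 < α) :
    ∃ (c₁ : Euc n) (c₂ c₃ : ℝ), 0 < c₂ ∧ ∀ x,
      fgmPhi μ A α u (fun x => r x - r z + inner ℝ g (x - z)) x =
        α * (inner ℝ c₁ x + r x + c₂ * ‖x‖ ^ 2) + c₃ := by
  have h : 0 < 1 + A * μ := by positivity
  refine ⟨g - ((1 + A * μ) / α) • u, (1 + A * μ) / (2 * α),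
    (1 + A * μ) / 2 * ‖u‖ ^ 2 - α * r z - α * inner ℝ g z, by positivity, fun x => ?_⟩
  simp only [fgmPhi, inner_sub_left, inner_sub_right, real_inner_smul_left,
    @norm_sub_sq ℝ, RCLike.re_to_real, real_inner_comm u x]
  field_simp
  ring

/-- The whole method: `N` iterations of the fast gradient method from `x⁰` with the
model constant `2 L`, where `L = L_xx + 2 L_xy² / μ_y`, and with `K` iterations of the ellipsoid
method for each inner maximization. -/
def ApproachTwo {n m : ℕ} (Qx : Set (Euc n)) (Qy : Set (Euc m)) (r : Euc n → ℝ)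
    (F : Euc n → Euc m → ℝ) (c : Euc m) (Lxx Lxy μx μy ℛ : ℝ) (N K : ℕ) (x₀ : Euc n)
    (out : Euc n) (k : OpCount) : Prop :=
  FGMRun Qx (2 * effL Lxx Lxy μy) μx (innerOracle Qy r F c ℛ K) N x₀ x₀ 0 out k

end

/-! The outer method sees the inner problem only through a model of `f = r + s`. If `y` maximizes
`F(z, ·)` up to `δ`, then `r(x) - r(z) + ⟨∇ₓF(z, y), x - z⟩`, with base value `r(z) + F(z, y)`, lies
below `f` by convexity and above it up to `L ‖x - z‖² + 2δ`: strong concavity in `y` absorbs the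
error made by using `∇ₓF(z, y)` instead of the gradient at the maximizer for `x`
(`IsSaddleProblem.isInexactModel`). For such models the fast gradient method has a potential whose
weight `A` grows by a factor `1 / (1 - θ)` per step, `θ = 1 / (1 + √(2L/μ_x))`, while the model
errors add up to at most `2δ/θ` (`IsInexactModel.step_le`, `FGMRun.bound`). With `δ = μ_x ε² θ / 8`
and `N` of order `(log 4 + ℓ)/θ`, the gap in `f` is at most `μ_x ε² / 2`, and quadratic growth of
`f` turns this into distance at most `ε`. The inner accuracy comes from a volume argument. Each step
multiplies the determinant by at most `exp(-1/(m+1))` (`det_nextMatrix_le`), so a small ball in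
`Q_y` near a maximizer cannot survive all the cuts. The centre whose cut hits the ball lies in `Q_y`
and is no worse than a point of the ball (`EllipsoidRun.mem_and_le`). -/

noncomputable section

/-! ### Minimizers of strongly convex functions. -/

section StrongConvexity

variable {E : Type*} [NormedAddCommGroup E] [NormedSpace ℝ E] {S : Set E} {σ : ℝ} {f : E → ℝ}

/-- A strongly convex function grows quadratically away from its minimizer. -/
lemma StrongConvexOn.add_sq_le_of_isMinOn (hf : StrongConvexOn S σ f) {p x : E} (hp : p ∈ S)
    (hmin : IsMinOn f S p) (hx : x ∈ S) : f p + σ / 2 * ‖x - p‖ ^ 2 ≤ f x := by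
  -- Compare `p` with a point of the segment to `x` and divide by `t`; the factor `1 - t` disappears
  -- as `t → 0⁺`.
  have key : ∀ t ∈ Ioo (0 : ℝ) 1, (1 - t) * (σ / 2 * ‖x - p‖ ^ 2) ≤ f x - f p := by
    intro t ht
    have h1 := hf.2 hx hp ht.1.le (sub_nonneg.2 ht.2.le) (by ring)
    have h2 : f p ≤ f (t • x + (1 - t) • p) :=
      hmin (hf.1 hx hp ht.1.le (sub_nonneg.2 ht.2.le) (by ring))
    simp only [smul_eq_mul] at h1
    have h3 : t * ((1 - t) * (σ / 2 * ‖x - p‖ ^ 2)) ≤ t * (f x - f p) := by linarith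
    exact le_of_mul_le_mul_left h3 ht.1
  have hlim : Filter.Tendsto (fun t : ℝ => (1 - t) * (σ / 2 * ‖x - p‖ ^ 2)) (nhdsWithin 0 (Ioi 0))
      (nhds ((1 - 0) * (σ / 2 * ‖x - p‖ ^ 2))) := by
    apply Filter.Tendsto.mono_left _ nhdsWithin_le_nhds
    exact Continuous.tendsto (by fun_prop) 0
  have h := le_of_tendsto hlim (Filter.eventually_of_mem (Ioo_mem_nhdsGT one_pos) key)
  linarith

/-- A continuous strongly convex function on a nonempty closed set of a finite-dimensional space
has a minimizer. -/
lemma StrongConvexOn.exists_isMinOn [ProperSpace E] (hf : StrongConvexOn S σ f) (hσ : 0 < σ)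
    (hc : ContinuousOn f S) (hS : IsClosed S) {x₀ : E} (hx₀ : x₀ ∈ S) :
    ∃ p ∈ S, IsMinOn f S p := by
  obtain ⟨q, hq, hqmin⟩ := ((isCompact_closedBall x₀ 1).inter_right hS).exists_isMinOn
    ⟨x₀, by simp, hx₀⟩ (hc.mono inter_subset_right)
  refine hc.exists_isMinOn' hS hx₀ ?_
  -- Coercivity: the point of the segment at distance 1 from `x₀` has value at least `f q`, and
  -- strong convexity then forces `f x₀ ≤ f x` once `x` is this far away.
  have hfar : ∀ᶠ x in Filter.cocompact E, 1 + 2 * (f x₀ - f q) / σ < ‖x - x₀‖ := by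
    filter_upwards [(isCompact_closedBall x₀ (1 + 2 * (f x₀ - f q) / σ)).compl_mem_cocompact]
      with x hx
    simpa [dist_eq_norm] using hx
  rw [Filter.eventually_inf_principal]
  filter_upwards [hfar] with x hx hxS
  have hq₀ : f q ≤ f x₀ := hqmin ⟨by simp, hx₀⟩
  set d := ‖x - x₀‖ with hd
  have hd1 : 1 < d := lt_of_le_of_lt (by have : 0 ≤ 2 * (f x₀ - f q) / σ := by
                                          have := sub_nonneg.2 hq₀; positivity
                                         linarith) hx
  have hd0 : 0 < d := by linarith
  have ht0 : 0 ≤ d⁻¹ := by positivity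
  have ht1 : 0 ≤ 1 - d⁻¹ := sub_nonneg.2 (inv_le_one_of_one_le₀ hd1.le)
  have h1 := hf.2 hxS hx₀ ht0 ht1 (by ring)
  have hmem : d⁻¹ • x + (1 - d⁻¹) • x₀ ∈ Metric.closedBall x₀ 1 ∩ S := by
    refine ⟨?_, hf.1 hxS hx₀ ht0 ht1 (by ring)⟩
    have : d⁻¹ • x + (1 - d⁻¹) • x₀ - x₀ = d⁻¹ • (x - x₀) := by module
    rw [mem_closedBall_iff_norm, this, norm_smul, Real.norm_of_nonneg ht0, ← hd,
      inv_mul_cancel₀ hd0.ne']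
  have h2 : f q ≤ f (d⁻¹ • x + (1 - d⁻¹) • x₀) := hqmin hmem
  simp only [smul_eq_mul, ← hd] at h1
  have h3 : d * f q ≤ f x + (d - 1) * f x₀ - (d - 1) * (σ / 2 * d) := by
    have := mul_le_mul_of_nonneg_left (h2.trans h1) hd0.le
    field_simp at this ⊢
    linarith
  have h4 : f x₀ - f q ≤ (d - 1) * σ / 2 := by
    have : 2 * (f x₀ - f q) / σ < d - 1 := by linarith
    rw [div_lt_iff₀ hσ] at this
    linarith
  nlinarith

end StrongConvexity

/-! ### First-order inequalities on convex sets. -/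

section Gradient

variable {E : Type*} [NormedAddCommGroup E] [InnerProductSpace ℝ E] [CompleteSpace E]
  {S : Set E} {f : E → ℝ}

lemma HasGradientAt.hasDerivAt_add_smul {g x d : E} {t : ℝ} (h : HasGradientAt f g (x + t • d)) :
    HasDerivAt (fun s : ℝ => f (x + s • d)) (inner ℝ g d) t := by
  have h1 : HasDerivAt (fun s : ℝ => x + s • d) d t := by
    simpa using ((hasDerivAt_id t).smul_const d).const_add x
  have h2 := (hasGradientAt_iff_hasFDerivAt.1 h).comp_hasDerivAt t h1
  simpa using! h2

/-- The gradient inequality for convex functions. -/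
lemma ConvexOn.add_inner_le (hf : ConvexOn ℝ S f) {g x y : E} (h : HasGradientAt f g x)
    (hx : x ∈ S) (hy : y ∈ S) : f x + inner ℝ g (y - x) ≤ f y := by
  have h1 : HasDerivAt (fun s : ℝ => f (x + s • (y - x))) (inner ℝ g (y - x)) 0 :=
    HasGradientAt.hasDerivAt_add_smul (by simpa using h)
  have h2 := h1.tendsto_slope_zero_right
  have h3 : inner ℝ g (y - x) ≤ f y - f x := by
    refine le_of_tendsto h2 (Filter.eventually_of_mem (Ioo_mem_nhdsGT one_pos) fun t ht => ?_)
    have h4 := hf.2 hy hx ht.1.le (sub_nonneg.2 ht.2.le) (by ring)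
    have h5 : x + t • (y - x) = t • y + (1 - t) • x := by module
    simp only [zero_add, zero_smul, add_zero, smul_eq_mul] at h4 ⊢
    rw [h5, inv_mul_le_iff₀ ht.1]
    linarith
  linarith

/-- The descent lemma on a convex set. -/
lemma Convex.le_add_inner_add_sq (hS : Convex ℝ S) {L : ℝ}
    (hd : ∀ x ∈ S, DifferentiableAt ℝ f x)
    (hL : ∀ x ∈ S, ∀ x' ∈ S, ‖gradient f x - gradient f x'‖ ≤ L * ‖x - x'‖) {x y : E} (hx : x ∈ S)
    (hy : y ∈ S) : f y ≤ f x + inner ℝ (gradient f x) (y - x) + L / 2 * ‖y - x‖ ^ 2 := by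
  have hmem : ∀ t ∈ Icc (0 : ℝ) 1, x + t • (y - x) ∈ S := fun t ht =>
    hS.add_smul_sub_mem hx hy ht
  -- Subtracting the claimed upper bound along the segment leaves a function with nonpositive
  -- derivative, by the Lipschitz condition.
  set φ : ℝ → ℝ := fun t => f (x + t • (y - x)) - t * inner ℝ (gradient f x) (y - x)
    - L / 2 * ‖y - x‖ ^ 2 * t ^ 2 with hφ
  have hder : ∀ t ∈ Icc (0 : ℝ) 1, HasDerivAt φ (inner ℝ (gradient f (x + t • (y - x))) (y - x)
      - inner ℝ (gradient f x) (y - x) - L / 2 * ‖y - x‖ ^ 2 * (2 * t)) t := by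
    intro t ht
    have h1 := HasGradientAt.hasDerivAt_add_smul (hd _ (hmem t ht)).hasGradientAt
    have h2 := (hasDerivAt_id t).mul_const (inner ℝ (gradient f x) (y - x))
    have h3 := ((hasDerivAt_id t).pow 2).const_mul (L / 2 * ‖y - x‖ ^ 2)
    have h4 : HasDerivAt φ _ t := (h1.sub h2).sub h3
    exact h4.congr_deriv (by simp)
  have hanti : AntitoneOn φ (Icc 0 1) := by
    refine antitoneOn_of_deriv_nonpos (convex_Icc 0 1)
      (fun t ht => (hder t ht).continuousAt.continuousWithinAt)
      (fun t ht => (hder t (interior_subset ht)).differentiableAt.differentiableWithinAt)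
      fun t ht => ?_
    have ht' := interior_subset ht
    rw [(hder t ht').deriv, ← inner_sub_left]
    have h1 := real_inner_le_norm (gradient f (x + t • (y - x)) - gradient f x) (y - x)
    have h2 := hL _ (hmem t ht') _ hx
    rw [add_sub_cancel_left, norm_smul, Real.norm_of_nonneg ht'.1] at h2
    have h3 := mul_le_mul_of_nonneg_right h2 (norm_nonneg (y - x))
    linarith
  have h := hanti (left_mem_Icc.2 zero_le_one) (right_mem_Icc.2 zero_le_one) zero_le_one
  simp only [hφ, one_smul, zero_smul, add_zero, add_sub_cancel] at h
  linarith

end Gradient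
end

noncomputable section

/-! ### Geometry of one ellipsoid step. -/

section Ellipsoid

variable {m : ℕ} {H : Matrix (Fin m) (Fin m) ℝ} {c x w : Euc m}

lemma inner_mulE (A : Matrix (Fin m) (Fin m) ℝ) (v w : Euc m) :
    inner ℝ v (mulE A w) = v.ofLp ⬝ᵥ A.mulVec w.ofLp := by
  rw [EuclideanSpace.inner_eq_star_dotProduct, dotProduct_comm]
  simp [mulE]

lemma mulE_sub (A : Matrix (Fin m) (Fin m) ℝ) (v w : Euc m) :
    mulE A (v - w) = mulE A v - mulE A w := by
  simp [mulE, Matrix.mulVec_sub]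

lemma mulE_add (A : Matrix (Fin m) (Fin m) ℝ) (v w : Euc m) :
    mulE A (v + w) = mulE A v + mulE A w := by
  simp [mulE, Matrix.mulVec_add]

lemma mulE_smul (A : Matrix (Fin m) (Fin m) ℝ) (a : ℝ) (w : Euc m) :
    mulE A (a • w) = a • mulE A w := by
  simp [mulE, Matrix.mulVec_smul]

lemma mulE_mulE (A B : Matrix (Fin m) (Fin m) ℝ) (w : Euc m) :
    mulE A (mulE B w) = mulE (A * B) w := by
  simp [mulE, Matrix.mulVec_mulVec]

lemma mulE_one (w : Euc m) : mulE 1 w = w := by simp [mulE]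

namespace Matrix.PosDef

lemma inner_mulE_pos (hH : H.PosDef) (hw : w ≠ 0) : 0 < inner ℝ w (mulE H w) := by
  rw [inner_mulE]
  simpa using hH.dotProduct_mulVec_pos (x := w.ofLp) (by simpa using hw)

lemma inner_mulE_nonneg (hH : H.PosDef) (w : Euc m) : 0 ≤ inner ℝ w (mulE H w) := by
  rcases eq_or_ne w 0 with rfl | hw
  · simp
  · exact (hH.inner_mulE_pos hw).le

lemma transpose_eq (hH : H.PosDef) : H.transpose = H := by
  simpa [Matrix.conjTranspose_eq_transpose_of_trivial] using hH.isHermitian.eq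

lemma inner_mulE_comm (hH : H.PosDef) (v w : Euc m) :
    inner ℝ v (mulE H w) = inner ℝ w (mulE H v) := by
  rw [inner_mulE, inner_mulE, dotProduct_comm, Matrix.dotProduct_mulVec,
    ← Matrix.mulVec_transpose, hH.transpose_eq]

lemma vecMul_eq (hH : H.PosDef) (v : Fin m → ℝ) : Matrix.vecMul v H = H.mulVec v := by
  rw [← Matrix.mulVec_transpose, hH.transpose_eq]

lemma inv_mul_self (hH : H.PosDef) : H⁻¹ * H = 1 :=
  Matrix.nonsing_inv_mul _ ((Matrix.isUnit_iff_isUnit_det _).1 hH.isUnit)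

lemma mul_inv_self (hH : H.PosDef) : H * H⁻¹ = 1 :=
  Matrix.mul_nonsing_inv _ ((Matrix.isUnit_iff_isUnit_det _).1 hH.isUnit)

/-- The Cauchy-Schwarz inequality for the forms of `H` and `H⁻¹`. -/
lemma inner_sq_le (hH : H.PosDef) (v w : Euc m) :
    inner ℝ w v ^ 2 ≤ inner ℝ w (mulE H w) * inner ℝ v (mulE H⁻¹ v) := by
  rcases eq_or_ne w 0 with rfl | hw
  · simp
  have hσ := hH.inner_mulE_pos hw
  set σ := inner ℝ w (mulE H w) with hσd
  have h := hH.inv.inner_mulE_nonneg (σ • v - inner ℝ w v • mulE H w)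
  have e1 : inner ℝ v (mulE H⁻¹ (mulE H w)) = inner ℝ w v := by
    rw [mulE_mulE, hH.inv_mul_self, mulE_one, real_inner_comm]
  have e2 : inner ℝ (mulE H w) (mulE H⁻¹ v) = inner ℝ w v := by
    rw [hH.inv.inner_mulE_comm, e1]
  have e3 : inner ℝ (mulE H w) (mulE H⁻¹ (mulE H w)) = σ := by
    rw [mulE_mulE, hH.inv_mul_self, mulE_one, real_inner_comm]
  simp only [mulE_sub, mulE_smul, inner_sub_left, inner_sub_right, real_inner_smul_left,
    real_inner_smul_right, e1, e2, e3] at h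
  have h' : 0 ≤ σ * (σ * inner ℝ v (mulE H⁻¹ v) - inner ℝ w v ^ 2) := by linarith
  linarith [nonneg_of_mul_nonneg_right h' hσ]

end Matrix.PosDef

/-- The inverse of the matrix of the next ellipsoid. -/
def nextInv (H : Matrix (Fin m) (Fin m) ℝ) (w : Euc m) : Matrix (Fin m) (Fin m) ℝ :=
  (((m : ℝ) ^ 2 - 1) / (m : ℝ) ^ 2) •
    (H⁻¹ + (2 / ((m : ℝ) - 1) * (1 / inner ℝ w (mulE H w))) • Matrix.vecMulVec w.ofLp w.ofLp)

lemma nextInv_posDef (hm : 2 ≤ m) (hH : H.PosDef) (hw : w ≠ 0) : (nextInv H w).PosDef := by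
  have hm' : (2 : ℝ) ≤ m := by exact_mod_cast hm
  have hσ := hH.inner_mulE_pos hw
  refine Matrix.PosDef.smul (hH.inv.add_posSemidef (Matrix.PosSemidef.smul ?_ ?_)) ?_
  · simpa using Matrix.posSemidef_vecMulVec_self_star w.ofLp
  · have : 0 < (m : ℝ) - 1 := by linarith
    positivity
  · have : 0 < (m : ℝ) ^ 2 - 1 := by nlinarith
    positivity

/-- Sherman–Morrison: every rank-one term is a multiple of `H w wᵀ`, and the coefficients cancel
because `2/(m-1) - 2/(m+1) = 4/(m²-1)`. -/
lemma nextMatrix_mul_nextInv (hm : 2 ≤ m) (hH : H.PosDef) (hw : w ≠ 0) :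
    nextMatrix H w * nextInv H w = 1 := by
  have hm' : (2 : ℝ) ≤ m := by exact_mod_cast hm
  have hσ := hH.inner_mulE_pos hw
  have h1 : (m : ℝ) ^ 2 - 1 ≠ 0 := by nlinarith
  have h2 : (m : ℝ) - 1 ≠ 0 := by linarith
  have h3 : (m : ℝ) + 1 ≠ 0 := by linarith
  have h4 : H.mulVec w.ofLp ⬝ᵥ w.ofLp = inner ℝ w (mulE H w) := by
    rw [inner_mulE, dotProduct_comm]
  have h5 : Matrix.vecMul (H.mulVec w.ofLp) H⁻¹ = w.ofLp := by
    rw [hH.inv.vecMul_eq, Matrix.mulVec_mulVec, hH.inv_mul_self, Matrix.one_mulVec]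
  rw [nextMatrix, if_neg (by omega), nextInv, hH.vecMul_eq]
  set σ := inner ℝ w (mulE H w)
  set b := H.mulVec w.ofLp with hb
  have p1 : Matrix.vecMulVec b b * H⁻¹ = Matrix.vecMulVec b w.ofLp := by
    rw [Matrix.vecMulVec_mul, h5]
  have p2 : H * Matrix.vecMulVec w.ofLp w.ofLp = Matrix.vecMulVec b w.ofLp := by
    rw [Matrix.mul_vecMulVec]
  have p3 : Matrix.vecMulVec b b * Matrix.vecMulVec w.ofLp w.ofLp
      = σ • Matrix.vecMulVec b w.ofLp := by
    rw [Matrix.vecMulVec_mul_vecMulVec, h4]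
    simp [Matrix.vecMulVec_smul]
  simp only [Matrix.smul_mul, Matrix.mul_smul, Matrix.sub_mul, Matrix.mul_add, hH.mul_inv_self,
    p1, p2, p3]
  have h6 : (m : ℝ) ≠ 0 := by linarith
  match_scalars
  · field_simp
  · field_simp
    ring

/-- For `m ≥ 2` positivity is read off the inverse, where the rank-one term is added rather than
subtracted. -/
lemma nextMatrix_posDef (hm : 1 ≤ m) (hH : H.PosDef) (hw : w ≠ 0) : (nextMatrix H w).PosDef := by
  rcases hm.eq_or_lt with h | h
  · rw [nextMatrix, if_pos h.symm]
    exact hH.smul (by norm_num)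
  · rw [← Matrix.inv_eq_left_inv (nextMatrix_mul_nextInv h hH hw)]
    exact (nextInv_posDef h hH hw).inv

/-- For `m ≥ 2` the matrix determinant lemma gives the exact ratio `(1 + 1/(m²-1))^(m-1) (1 -
1/(m+1))²`, and `1 + x ≤ exp x` bounds the factors by `exp(1/(m+1))` and `exp(-2/(m+1))`. -/
lemma det_nextMatrix_le (hm : 1 ≤ m) (hH : H.PosDef) (hw : w ≠ 0) :
    (nextMatrix H w).det ≤ Real.exp (-(1 / ((m : ℝ) + 1))) * H.det := by
  have hσ := hH.inner_mulE_pos hw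
  rcases hm.eq_or_lt with h | h
  · subst h
    rw [nextMatrix, if_pos rfl, Matrix.det_smul]
    refine mul_le_mul_of_nonneg_right ?_ hH.det_pos.le
    have := Real.add_one_le_exp (-(1 / (((1 : ℕ) : ℝ) + 1)))
    norm_num at this ⊢
    linarith
  · have hm' : (2 : ℝ) ≤ m := by exact_mod_cast (h : 2 ≤ m)
    have h1 : 0 < (m : ℝ) - 1 := by linarith
    have hdet : (nextMatrix H w).det
        = ((m : ℝ) ^ 2 / ((m : ℝ) ^ 2 - 1)) ^ m * (1 - 2 / ((m : ℝ) + 1)) * H.det := by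
      rw [nextMatrix, if_neg (by omega), Matrix.det_smul, hH.vecMul_eq, sub_eq_add_neg H, ← neg_smul,
        ← Matrix.smul_vecMulVec, Matrix.vecMulVec_eq Unit,
        Matrix.det_add_replicateCol_mul_replicateRow ((Matrix.isUnit_iff_isUnit_det _).1 hH.isUnit),
        ← Matrix.replicateRow_vecMul, Matrix.det_unique (n := Unit), Matrix.add_apply, Matrix.one_apply_eq,
        Matrix.replicateRow_mul_replicateCol_apply, hH.inv.vecMul_eq, Matrix.mulVec_mulVec,
        hH.inv_mul_self, Matrix.one_mulVec, dotProduct_smul, ← inner_mulE, Fintype.card_fin,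
        smul_eq_mul]
      field_simp
      ring
    rw [hdet]
    refine mul_le_mul_of_nonneg_right ?_ hH.det_pos.le
    have e1 : ((m : ℝ) ^ 2 / ((m : ℝ) ^ 2 - 1)) ^ m * (1 - 2 / ((m : ℝ) + 1))
        = (1 + 1 / ((m : ℝ) ^ 2 - 1)) ^ (m - 1) * (1 - 1 / ((m : ℝ) + 1)) ^ 2 := by
      obtain ⟨k, rfl⟩ : ∃ k, m = k + 1 := ⟨m - 1, by omega⟩
      have h2 : ((k + 1 : ℕ) : ℝ) ^ 2 - 1 ≠ 0 := by nlinarith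
      have h3 : 1 + 1 / (((k + 1 : ℕ) : ℝ) ^ 2 - 1)
        = ((k + 1 : ℕ) : ℝ) ^ 2 / (((k + 1 : ℕ) : ℝ) ^ 2 - 1) := by field_simp; ring
      rw [h3, Nat.add_sub_cancel, pow_succ, mul_assoc]
      congr 1
      field_simp
      ring
    have e2 : (1 + 1 / ((m : ℝ) ^ 2 - 1)) ^ (m - 1) ≤ Real.exp (1 / ((m : ℝ) + 1)) := by
      have h2 : 0 < (m : ℝ) ^ 2 - 1 := by nlinarith
      calc (1 + 1 / ((m : ℝ) ^ 2 - 1)) ^ (m - 1)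
          ≤ Real.exp (1 / ((m : ℝ) ^ 2 - 1)) ^ (m - 1) := by
            gcongr
            linarith [Real.add_one_le_exp (1 / ((m : ℝ) ^ 2 - 1))]
        _ = Real.exp (1 / ((m : ℝ) + 1)) := by
            rw [← Real.exp_nat_mul]
            congr 1
            rw [Nat.cast_sub hm]
            have : (m : ℝ) ^ 2 - 1 = (m - 1) * (m + 1) := by ring
            rw [this]
            field_simp
            simp
    have e3 : (1 - 1 / ((m : ℝ) + 1)) ^ 2 ≤ Real.exp (-(2 / ((m : ℝ) + 1))) := by
      have h2 : 0 ≤ 1 - 1 / ((m : ℝ) + 1) := by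
        rw [sub_nonneg, div_le_one (by linarith)]; linarith
      calc (1 - 1 / ((m : ℝ) + 1)) ^ 2 ≤ Real.exp (-(1 / ((m : ℝ) + 1))) ^ 2 := by
            gcongr
            linarith [Real.add_one_le_exp (-(1 / ((m : ℝ) + 1)))]
        _ = Real.exp (-(2 / ((m : ℝ) + 1))) := by
            rw [← Real.exp_nat_mul]; congr 1; push_cast; ring
    calc _ = _ := e1
      _ ≤ Real.exp (1 / ((m : ℝ) + 1)) * Real.exp (-(2 / ((m : ℝ) + 1))) :=
        mul_le_mul e2 e3 (sq_nonneg _) (Real.exp_pos _).le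
      _ = Real.exp (-(1 / ((m : ℝ) + 1))) := by rw [← Real.exp_add]; congr 1; ring

/-- The next ellipsoid contains the half of the current one that is kept. -/
lemma mem_ellipsoidSet_next (hm : 1 ≤ m) (hH : H.PosDef) (hw : w ≠ 0)
    (hx : x ∈ ellipsoidSet c H) (hcut : inner ℝ w (x - c) ≤ 0) :
    x ∈ ellipsoidSet (nextCenter c H w) (nextMatrix H w) := by
  have hσ := hH.inner_mulE_pos hw
  simp only [ellipsoidSet, mem_ofPred_eq, nextCenter] at hx ⊢
  have hcs := hH.inner_sq_le (x - c) w
  set v := x - c with hv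
  set σ := inner ℝ w (mulE H w) with hσd
  set q := inner ℝ v (mulE H⁻¹ v) with hq
  set τ := Real.sqrt σ with hτ
  have hτ0 : 0 < τ := Real.sqrt_pos.2 hσ
  have hτσ : τ ^ 2 = σ := Real.sq_sqrt hσ.le
  set a : ℝ := 1 / ((m : ℝ) + 1) * (1 / τ) with ha
  have hxv : x - (c - a • mulE H w) = v + a • mulE H w := by rw [hv]; abel
  -- `t` is the normalized coordinate of `v` along `w`. Cauchy–Schwarz gives `t² ≤ q ≤ 1` and the
  -- cut gives `t ≤ 0`, hence `t² + t ≤ 0`, which is what the new ellipsoid needs.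
  set t := inner ℝ w v / τ with ht
  have htv : inner ℝ w v = t * τ := by rw [ht]; field_simp
  have ht0 : t ≤ 0 := div_nonpos_of_nonpos_of_nonneg hcut hτ0.le
  have htq : t ^ 2 ≤ q := by
    rw [htv, ← hτσ, mul_pow, mul_comm] at hcs
    exact le_of_mul_le_mul_left hcs (by positivity)
  have ht1 : -1 ≤ t := by nlinarith
  have htt : t ^ 2 + t ≤ 0 := by nlinarith
  have e1 : inner ℝ v (mulE H⁻¹ (mulE H w)) = t * τ := by
    rw [mulE_mulE, hH.inv_mul_self, mulE_one, real_inner_comm, htv]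
  have e2 : inner ℝ (mulE H w) (mulE H⁻¹ v) = t * τ := by
    rw [hH.inv.inner_mulE_comm, e1]
  have e3 : inner ℝ (mulE H w) (mulE H⁻¹ (mulE H w)) = τ ^ 2 := by
    rw [mulE_mulE, hH.inv_mul_self, mulE_one, real_inner_comm, hτσ]
  have haτ : a * τ = 1 / ((m : ℝ) + 1) := by rw [ha]; field_simp
  have hform : inner ℝ (v + a • mulE H w) (mulE H⁻¹ (v + a • mulE H w))
      = q + 2 * t * (1 / ((m : ℝ) + 1)) + (1 / ((m : ℝ) + 1)) ^ 2 := by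
    simp only [mulE_add, mulE_smul, inner_add_left, inner_add_right, real_inner_smul_left,
      real_inner_smul_right, e1, e2, e3, ← hq, ← haτ]
    ring
  rw [hxv]
  rcases hm.eq_or_lt with h | h
  -- In dimension one `v` is a multiple of `H w`, so Cauchy–Schwarz is an equality.
  · have hqt : q = t ^ 2 := by
      have hb : mulE H w ≠ 0 := fun h0 => by simp [hσd, h0] at hσ
      obtain ⟨s, hs⟩ : ∃ s : ℝ, v = s • mulE H w := by
        subst h
        have hb0 : mulE H w 0 ≠ 0 := fun h0 => hb (by ext i; fin_cases i; simpa using h0)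
        exact ⟨v 0 / mulE H w 0, by ext i; fin_cases i; simp [hb0]⟩
      have h2 : t * τ = s * τ ^ 2 := by rw [← htv, hs, real_inner_smul_right, hτσ]
      have h3 : t = s * τ := mul_right_cancel₀ hτ0.ne' (by rw [h2]; ring)
      rw [hq, hs, mulE_smul, real_inner_smul_left, real_inner_smul_right, e3, h3]
      ring
    have hinv : (nextMatrix H w)⁻¹ = (4 : ℝ) • H⁻¹ := by
      apply Matrix.inv_eq_right_inv
      rw [nextMatrix, if_pos h.symm, Matrix.smul_mul, Matrix.mul_smul, hH.mul_inv_self, smul_smul]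
      norm_num
    have h4 : mulE ((4 : ℝ) • H⁻¹) (v + a • mulE H w) = (4 : ℝ) • mulE H⁻¹ (v + a • mulE H w) := by
      simp [mulE, Matrix.smul_mulVec]
    rw [hinv, h4, real_inner_smul_right, hform, ← h, hqt]
    push_cast
    nlinarith
  · have hm' : (2 : ℝ) ≤ m := by exact_mod_cast (h : 2 ≤ m)
    have h1 : 0 < (m : ℝ) - 1 := by linarith
    have hwv : inner ℝ w (v + a • mulE H w) = (t + 1 / ((m : ℝ) + 1)) * τ := by
      rw [inner_add_right, real_inner_smul_right, htv, ← hσd, ← hτσ, ← haτ]; ring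
    have h4 : inner ℝ (v + a • mulE H w) (mulE (nextInv H w) (v + a • mulE H w))
        = ((m : ℝ) ^ 2 - 1) / (m : ℝ) ^ 2 *
          (inner ℝ (v + a • mulE H w) (mulE H⁻¹ (v + a • mulE H w)) +
            2 / ((m : ℝ) - 1) * (1 / σ) * inner ℝ w (v + a • mulE H w) ^ 2) := by
      rw [inner_mulE, inner_mulE, nextInv, Matrix.smul_mulVec, Matrix.add_mulVec,
        Matrix.smul_mulVec, Matrix.vecMulVec_mulVec]
      have : inner ℝ w (v + a • mulE H w) = w.ofLp ⬝ᵥ (v + a • mulE H w).ofLp := by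
        rw [EuclideanSpace.inner_eq_star_dotProduct, dotProduct_comm]; simp
      rw [this, ← hσd]
      simp only [dotProduct_smul, dotProduct_add, smul_eq_mul, op_smul_eq_smul]
      rw [dotProduct_comm _ w.ofLp]
      ring
    rw [Matrix.inv_eq_right_inv (nextMatrix_mul_nextInv h hH hw), h4, hform, hwv, mul_pow, ← hτσ]
    have h5 : (q + 2 * t * (1 / ((m : ℝ) + 1)) + (1 / ((m : ℝ) + 1)) ^ 2 +
        2 / ((m : ℝ) - 1) * (1 / τ ^ 2) * ((t + 1 / ((m : ℝ) + 1)) ^ 2 * τ ^ 2))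
        = q + 1 / ((m : ℝ) ^ 2 - 1) + 2 / ((m : ℝ) - 1) * (t ^ 2 + t) := by
      have : (m : ℝ) ^ 2 - 1 = (m - 1) * (m + 1) := by ring
      rw [this]
      field_simp
      ring
    have h6 : 0 < (m : ℝ) ^ 2 - 1 := by nlinarith
    have h7 : 2 / ((m : ℝ) - 1) * (t ^ 2 + t) ≤ 0 :=
      mul_nonpos_of_nonneg_of_nonpos (by positivity) htt
    rw [h5, div_mul_eq_mul_div, div_le_one (by positivity)]
    calc ((m : ℝ) ^ 2 - 1) * (q + 1 / ((m : ℝ) ^ 2 - 1) + 2 / ((m : ℝ) - 1) * (t ^ 2 + t))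
        ≤ ((m : ℝ) ^ 2 - 1) * (1 + 1 / ((m : ℝ) ^ 2 - 1)) := by exact mul_le_mul_of_nonneg_left (by linarith) h6.le
      _ = (m : ℝ) ^ 2 := by field_simp; ring

/-- An ellipsoid containing a ball of radius `a` has determinant at least `a ^ (2 m)`. -/
lemma pow_le_det_of_closedBall_subset (hH : H.PosDef) {p : Euc m} {a : ℝ} (ha : 0 < a)
    (h : Metric.closedBall p a ⊆ ellipsoidSet c H) : a ^ (2 * m) ≤ H.det := by
  -- Averaging the conditions at `p + v` and `p - v` removes the unknown offset `p - c`; the form of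
  -- `H⁻¹` is thus at most 1 on the centred ball, which bounds its eigenvalues by `a⁻²`.
  have h1 : ∀ v : Euc m, ‖v‖ ≤ a → inner ℝ v (mulE H⁻¹ v) ≤ 1 := by
    intro v hv
    have h2 : p + v ∈ ellipsoidSet c H := h (by simpa using hv)
    have h3 : p - v ∈ ellipsoidSet c H := h (by simpa [dist_eq_norm] using hv)
    simp only [ellipsoidSet, mem_ofPred_eq] at h2 h3
    have e1 : p + v - c = (p - c) + v := by abel
    have e2 : p - v - c = (p - c) - v := by abel
    rw [e1] at h2
    rw [e2] at h3
    have h4 := hH.inv.inner_mulE_nonneg (p - c)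
    simp only [mulE_add, mulE_sub, inner_add_left, inner_add_right, inner_sub_left,
      inner_sub_right] at h2 h3 h4
    linarith
  have hinv := hH.inv
  have h5 : ∀ i, hinv.isHermitian.eigenvalues i ≤ (a ^ 2)⁻¹ := by
    intro i
    set e := hinv.isHermitian.eigenvectorBasis i with he
    have hn : ‖e‖ = 1 := hinv.isHermitian.eigenvectorBasis.norm_eq_one i
    have h6 : mulE H⁻¹ e = hinv.isHermitian.eigenvalues i • e := by
      have := hinv.isHermitian.mulVec_eigenvectorBasis i
      simp only [mulE, he]
      rw [this]
      simp
    have h7 := h1 (a • e) (by rw [norm_smul, hn, Real.norm_of_nonneg ha.le, mul_one])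
    rw [mulE_smul, h6, real_inner_smul_left, real_inner_smul_right, real_inner_smul_right,
      real_inner_self_eq_norm_sq, hn] at h7
    have h8 : hinv.isHermitian.eigenvalues i * a ^ 2 ≤ 1 := by linarith
    exact (le_div_iff₀ (by positivity)).2 h8 |>.trans_eq (one_div _)
  have h6 : H⁻¹.det ≤ ((a ^ 2)⁻¹) ^ m := by
    rw [hinv.isHermitian.det_eq_prod_eigenvalues]
    calc _ ≤ ∏ _i : Fin m, (a ^ 2)⁻¹ :=
          Finset.prod_le_prod (fun i _ => (hinv.eigenvalues_pos i).le) fun i _ => h5 i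
      _ = _ := by simp
  have h7 : H.det * H⁻¹.det = 1 := by rw [← Matrix.det_mul, hH.mul_inv_self, Matrix.det_one]
  have h8 := mul_le_mul_of_nonneg_left h6 hH.det_pos.le
  rw [h7, inv_pow, ← pow_mul, ← div_eq_mul_inv, one_le_div (by positivity)] at h8
  exact h8

end Ellipsoid
end

noncomputable section

/-! ### Accuracy and feasibility of the ellipsoid method. -/

section EllipsoidMethod

variable {m : ℕ} {Q : Set (Euc m)} {g : Euc m → ℝ}

/-- The invariant of the inductions on runs: the determinant, discounted for the `K` steps still to
come, is below the bound `b`. -/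
lemma exp_mul_det_nextMatrix_lt (hm : 1 ≤ m) {H : Matrix (Fin m) (Fin m) ℝ} (hH : H.PosDef)
    {w : Euc m} (hw : w ≠ 0) {K : ℕ} {b : ℝ}
    (h : Real.exp (-((K + 1 : ℕ) / ((m : ℝ) + 1))) * H.det < b) :
    Real.exp (-(K / ((m : ℝ) + 1))) * (nextMatrix H w).det < b := by
  refine lt_of_le_of_lt ?_ h
  calc _ ≤ Real.exp (-(K / ((m : ℝ) + 1))) * (Real.exp (-(1 / ((m : ℝ) + 1))) * H.det) :=
        mul_le_mul_of_nonneg_left (det_nextMatrix_le hm hH hw) (Real.exp_pos _).le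
    _ = _ := by
        rw [← mul_assoc, ← Real.exp_add]
        congr 2
        push_cast
        ring

lemma EllipsoidRun.count_le {δ : ℝ} {K s t : ℕ} {V : Set (Euc m)} {c out : Euc m}
    {H : Matrix (Fin m) (Fin m) ℝ} (h : EllipsoidRun δ Q g K V c H out s t) : s ≤ K ∧ t ≤ K := by
  induction h <;> omega

/-- If `g ≤ G` on a ball in `Q`, and the volume of the ellipsoid drops below that of the ball, the
run ends at a point of `Q` where `g ≤ G`. -/
lemma EllipsoidRun.mem_and_le (hm : 1 ≤ m) {p : Euc m} {a G : ℝ} (ha : 0 < a)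
    (hpQ : Metric.closedBall p a ⊆ Q) (hG : ∀ x ∈ Metric.closedBall p a, g x ≤ G)
    {K s t : ℕ} {V : Set (Euc m)} {c out : Euc m} {H : Matrix (Fin m) (Fin m) ℝ}
    (h : EllipsoidRun 0 Q g K V c H out s t) (hH : H.PosDef) (hcV : c ∈ V)
    (hdet : Real.exp (-(K / ((m : ℝ) + 1))) * H.det < a ^ (2 * m))
    (hinv : (∃ v ∈ V ∩ Q, g v ≤ G) ∨ Metric.closedBall p a ⊆ ellipsoidSet c H) :
    out ∈ Q ∧ g out ≤ G := by
  induction h with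
  | finish hout hmin =>
    rcases hinv with ⟨v, hv, hvG⟩ | hsub
    · exact ⟨hout.2, (hmin hv).trans hvG⟩
    -- With no steps left the determinant is too small for the ellipsoid to contain the ball.
    · have := pow_le_det_of_closedBall_subset hH ha hsub
      simp at hdet
      linarith
  | stationary hc hw =>
    refine ⟨hc, ?_⟩
    have hp : p ∈ Metric.closedBall p a := Metric.mem_closedBall_self ha.le
    have := hw p (hpQ hp)
    simp only [inner_zero_left] at this
    linarith [hG p hp]
  | @inside K s t V c w out H hc hw hw0 next ih =>
    refine ih (nextMatrix_posDef hm hH hw0) (mem_insert _ _)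
      (exp_mul_det_nextMatrix_lt hm hH hw0 hdet) ?_
    rcases hinv with ⟨v, hv, hvG⟩ | hsub
    · exact Or.inl ⟨v, ⟨mem_insert_of_mem _ hv.1, hv.2⟩, hvG⟩
    -- If the cut removes a point `x` of the ball, the subgradient inequality gives `g c ≤ g x ≤ G`,
    -- so `c` is a good centre.
    · by_cases hcut : ∀ x ∈ Metric.closedBall p a, inner ℝ w (x - c) ≤ 0
      · exact Or.inr fun x hx => mem_ellipsoidSet_next hm hH hw0 (hsub hx) (hcut x hx)
      · push Not at hcut
        obtain ⟨x, hx, hxc⟩ := hcut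
        refine Or.inl ⟨c, ⟨mem_insert_of_mem _ hcV, hc⟩, ?_⟩
        linarith [hw x (hpQ hx), hG x hx]
  | @outside K s t V c w out H hc hw0 hw next ih =>
    refine ih (nextMatrix_posDef hm hH hw0) (mem_insert _ _)
      (exp_mul_det_nextMatrix_lt hm hH hw0 hdet) ?_
    rcases hinv with ⟨v, hv, hvG⟩ | hsub
    · exact Or.inl ⟨v, ⟨mem_insert_of_mem _ hv.1, hv.2⟩, hvG⟩
    · exact Or.inr fun x hx => mem_ellipsoidSet_next hm hH hw0 (hsub hx) (hw x ⟨hpQ hx, hsub hx⟩)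

lemma exists_separating (hQ : Convex ℝ Q) (hQc : IsClosed Q) (hne : Q.Nonempty) {c : Euc m}
    (hc : c ∉ Q) : ∃ w : Euc m, w ≠ 0 ∧ ∀ x ∈ Q, inner ℝ w (x - c) ≤ 0 := by
  obtain ⟨f, u, hf, hu⟩ := geometric_hahn_banach_closed_point hQ hQc hc
  have hw : ∀ x, inner ℝ ((InnerProductSpace.toDual ℝ (Euc m)).symm f) x = f x := fun x =>
    InnerProductSpace.toDual_symm_apply
  refine ⟨(InnerProductSpace.toDual ℝ (Euc m)).symm f, fun h0 => ?_, fun x hx => ?_⟩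
  · obtain ⟨x, hx⟩ := hne
    have h1 := hf x hx
    rw [← hw, h0, inner_zero_left] at h1 hu
    linarith
  · rw [hw, map_sub]
    linarith [hf x hx]

/-- The danger is that no centre falls in `Q`, leaving nothing to return. In that case all cuts are
separating, so `Q` stays inside the ellipsoid, which the final determinant forbids. -/
lemma EllipsoidRun.exists_run (hm : 1 ≤ m) (hQ : Convex ℝ Q) (hQc : IsClosed Q) {p : Euc m} {a : ℝ}
    (ha : 0 < a) (hpQ : Metric.closedBall p a ⊆ Q)
    (hsub : ∀ x ∈ Q, (deltaSubdiff 0 Q g x).Nonempty) (K : ℕ) :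
    ∀ (V : Set (Euc m)) (c : Euc m) (H : Matrix (Fin m) (Fin m) ℝ), V.Finite → H.PosDef → c ∈ V →
      Real.exp (-(K / ((m : ℝ) + 1))) * H.det < a ^ (2 * m) →
      ((V ∩ Q).Nonempty ∨ Q ⊆ ellipsoidSet c H) →
      ∃ (out : Euc m) (s t : ℕ), EllipsoidRun 0 Q g K V c H out s t := by
  induction K with
  | zero =>
    intro V c H hV hH hcV hdet hinv
    have hne : (V ∩ Q).Nonempty := by
      refine hinv.resolve_right fun h => ?_
      have := pow_le_det_of_closedBall_subset hH ha (hpQ.trans h)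
      simp at hdet
      linarith
    obtain ⟨out, hout, hmin⟩ := (hV.inter_of_left Q).exists_minimalFor g _ hne
    exact ⟨out, 0, 0, .finish hout fun x hx => (le_total (g out) (g x)).elim id (hmin hx)⟩
  | succ K ih =>
    intro V c H hV hH hcV hdet hinv
    by_cases hc : c ∈ Q
    · obtain ⟨w, hw⟩ := hsub c hc
      rcases eq_or_ne w 0 with rfl | hw0
      · exact ⟨c, 1, 0, .stationary hc hw⟩
      · obtain ⟨out, s, t, h⟩ := ih (insert (nextCenter c H w) V) (nextCenter c H w)
          (nextMatrix H w) (hV.insert _) (nextMatrix_posDef hm hH hw0) (mem_insert _ _)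
          (exp_mul_det_nextMatrix_lt hm hH hw0 hdet)
          (Or.inl ⟨c, mem_insert_of_mem _ hcV, hc⟩)
        exact ⟨out, _, _, .inside hc hw hw0 h⟩
    · obtain ⟨w, hw0, hw⟩ := exists_separating hQ hQc
        ⟨p, hpQ (Metric.mem_closedBall_self ha.le)⟩ hc
      obtain ⟨out, s, t, h⟩ := ih (insert (nextCenter c H w) V) (nextCenter c H w)
        (nextMatrix H w) (hV.insert _) (nextMatrix_posDef hm hH hw0) (mem_insert _ _)
        (exp_mul_det_nextMatrix_lt hm hH hw0 hdet)
        (hinv.imp (fun ⟨v, hv⟩ => ⟨v, mem_insert_of_mem _ hv.1, hv.2⟩)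
          fun h x hx => mem_ellipsoidSet_next hm hH hw0 (h hx) (hw x hx))
      exact ⟨out, _, _, .outside hc hw0 (fun x hx => hw x hx.1) h⟩

lemma posDef_sq_smul_one {ℛ : ℝ} (hℛ : 0 < ℛ) :
    ((ℛ ^ 2) • (1 : Matrix (Fin m) (Fin m) ℝ)).PosDef :=
  Matrix.PosDef.one.smul (by positivity)

lemma closedBall_subset_ellipsoidSet {ℛ : ℝ} (hℛ : 0 < ℛ) (c : Euc m) :
    Metric.closedBall c ℛ ⊆ ellipsoidSet c ((ℛ ^ 2) • (1 : Matrix (Fin m) (Fin m) ℝ)) := by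
  intro x hx
  rw [mem_closedBall_iff_norm] at hx
  have h1 : ((ℛ ^ 2) • (1 : Matrix (Fin m) (Fin m) ℝ))⁻¹ = (ℛ ^ 2)⁻¹ • 1 := by
    apply Matrix.inv_eq_right_inv
    rw [Matrix.smul_mul, Matrix.mul_smul, smul_smul, one_mul, mul_inv_cancel₀ (by positivity),
      one_smul]
  have h2 : mulE ((ℛ ^ 2)⁻¹ • (1 : Matrix (Fin m) (Fin m) ℝ)) (x - c) = (ℛ ^ 2)⁻¹ • (x - c) := by
    simp [mulE, Matrix.smul_mulVec]
  simp only [ellipsoidSet, mem_ofPred_eq, h1, h2, real_inner_smul_right,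
    real_inner_self_eq_norm_sq]
  rw [inv_mul_le_iff₀ (by positivity), mul_one]
  gcongr

/-- The number of iterations after which the ellipsoid method must have cut a ball of radius `a`
out of a ball of radius `ℛ`. -/
def ellipsoidSteps (m : ℕ) (ℛ a : ℝ) : ℕ :=
  ⌊2 * m * (m + 1) * Real.log (ℛ / a)⌋₊ + 1

/-- The initial determinant is `ℛ^(2m)`; the floor plus one in `ellipsoidSteps` makes the inequality
strict. -/
lemma exp_mul_det_lt (hm : 1 ≤ m) {ℛ a : ℝ} (hℛ : 0 < ℛ) (ha : 0 < a) :
    Real.exp (-(ellipsoidSteps m ℛ a / ((m : ℝ) + 1))) *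
      ((ℛ ^ 2) • (1 : Matrix (Fin m) (Fin m) ℝ)).det < a ^ (2 * m) := by
  have hm' : (0 : ℝ) < m := by exact_mod_cast hm
  have h1 : 2 * m * (m + 1) * Real.log (ℛ / a) < ellipsoidSteps m ℛ a := by
    rw [ellipsoidSteps]; push_cast; exact Nat.lt_floor_add_one _
  have h2 : Real.log (ℛ / a) * (2 * m : ℕ) < ellipsoidSteps m ℛ a / ((m : ℝ) + 1) := by
    rw [lt_div_iff₀ (by positivity)]
    push_cast
    linarith
  have h3 : (ℛ / a) ^ (2 * m) < Real.exp (ellipsoidSteps m ℛ a / ((m : ℝ) + 1)) := by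
    rw [← Real.rpow_natCast, Real.rpow_def_of_pos (by positivity)]
    exact Real.exp_lt_exp.2 h2
  rw [Matrix.det_smul, Matrix.det_one, mul_one, Fintype.card_fin, ← pow_mul, Real.exp_neg,
    inv_mul_lt_iff₀ (Real.exp_pos _)]
  rwa [div_pow, div_lt_iff₀ (by positivity)] at h3

/-- The ellipsoid method can be carried out to the end. -/
lemma EllipsoidMethod.exists_run (hm : 1 ≤ m) (hQ : Convex ℝ Q) (hQc : IsClosed Q) {c p : Euc m}
    {a ρ ℛ : ℝ} (ha : 0 < a) (haρ : a ≤ ρ) (hℛ : 0 < ℛ) (hpQ : Metric.closedBall p ρ ⊆ Q)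
    (hQℛ : Q ⊆ Metric.closedBall c ℛ) (hsub : ∀ x ∈ Q, (deltaSubdiff 0 Q g x).Nonempty) :
    ∃ (out : Euc m) (s t : ℕ), EllipsoidMethod 0 Q g (ellipsoidSteps m ℛ a) c ℛ out s t :=
  EllipsoidRun.exists_run hm hQ hQc ha ((Metric.closedBall_subset_closedBall haρ).trans hpQ) hsub _
    {c} c _ (finite_singleton c) (posDef_sq_smul_one hℛ) (mem_singleton c)
    (exp_mul_det_lt hm hℛ ha) (Or.inr (hQℛ.trans (closedBall_subset_ellipsoidSet hℛ c)))

/-- The accuracy of the ellipsoid method. -/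
lemma EllipsoidMethod.mem_and_le (hm : 1 ≤ m) (hg : ConvexOn ℝ Q g) {c p out : Euc m}
    {τ ρ ℛ B : ℝ} (hτ : 0 < τ) (hτ1 : τ ≤ 1) (hρ : 0 < ρ) (hℛ : 0 < ℛ)
    (hpQ : Metric.closedBall p ρ ⊆ Q) (hQℛ : Q ⊆ Metric.closedBall c ℛ)
    (hB : ∀ x ∈ Q, ∀ y ∈ Q, g x - g y ≤ B) {s t : ℕ}
    (h : EllipsoidMethod 0 Q g (ellipsoidSteps m ℛ (τ * ρ)) c ℛ out s t) {y : Euc m} (hy : y ∈ Q) :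
    out ∈ Q ∧ g out ≤ g y + τ * B := by
  -- Contract the ball of radius `ρ` towards `y` by the factor `τ`: the image stays in `Q`, and by
  -- convexity `g` exceeds `g y` by at most `τ B` on it.
  have hball : ∀ x ∈ Metric.closedBall ((1 - τ) • y + τ • p) (τ * ρ),
      ∃ q ∈ Q, x = (1 - τ) • y + τ • q := by
    intro x hx
    refine ⟨p + τ⁻¹ • (x - ((1 - τ) • y + τ • p)), hpQ ?_, ?_⟩
    · rw [mem_closedBall_iff_norm] at hx ⊢
      rw [add_sub_cancel_left, norm_smul, norm_inv, Real.norm_of_nonneg hτ.le,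
        inv_mul_le_iff₀ hτ]
      exact hx
    · rw [smul_add, smul_smul, mul_inv_cancel₀ hτ.ne']
      module
  have hball' : Metric.closedBall ((1 - τ) • y + τ • p) (τ * ρ) ⊆ Q := by
    intro x hx
    obtain ⟨q, hq, rfl⟩ := hball x hx
    exact hg.1 hy hq (sub_nonneg.2 hτ1) hτ.le (by ring)
  refine EllipsoidRun.mem_and_le hm (mul_pos hτ hρ) hball' ?_ h (posDef_sq_smul_one hℛ)
    (mem_singleton c) (exp_mul_det_lt hm hℛ (mul_pos hτ hρ))
    (Or.inr (hball'.trans (hQℛ.trans (closedBall_subset_ellipsoidSet hℛ c))))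
  intro x hx
  obtain ⟨q, hq, rfl⟩ := hball x hx
  have h1 := hg.2 hy hq (sub_nonneg.2 hτ1) hτ.le (by ring)
  simp only [smul_eq_mul] at h1
  nlinarith [hB q hq y hy]

end EllipsoidMethod
end

noncomputable section

/-! ### The fast gradient method with an inexact model. -/

section FastGradientMethod

variable {n : ℕ} {Q : Set (Euc n)} {f : Euc n → ℝ} {Λ μ δ : ℝ}
  {oracle : Euc n → (Euc n → ℝ) → OpCount → Prop}

/-- `ψ` is a continuous, `μ`-strongly convex `(δ, Λ)`-model of `f` on `Q` at the point `z`. -/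
structure IsInexactModel (Q : Set (Euc n)) (f : Euc n → ℝ) (Λ μ δ : ℝ) (z : Euc n)
    (ψ : Euc n → ℝ) : Prop where
  continuousOn : ContinuousOn ψ Q
  strongConvexOn : StrongConvexOn Q μ ψ
  bounds : ∃ fz : ℝ, (∀ x ∈ Q, fz + ψ x ≤ f x) ∧
    ∀ x ∈ Q, f x ≤ fz + ψ x + Λ / 2 * ‖x - z‖ ^ 2 + δ

lemma norm_combo_sub_sq {E : Type*} [NormedAddCommGroup E] [InnerProductSpace ℝ E] (x y u : E)
    {a b : ℝ} (hab : a + b = 1) :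
    ‖a • x + b • y - u‖ ^ 2 = a * ‖x - u‖ ^ 2 + b * ‖y - u‖ ^ 2 - a * b * ‖x - y‖ ^ 2 := by
  have h1 : a • x + b • y - u = a • (x - u) + b • (y - u) := by
    obtain rfl := eq_sub_of_add_eq hab
    module
  have h2 : ‖x - y‖ ^ 2 = ‖x - u‖ ^ 2 - 2 * inner ℝ (x - u) (y - u) + ‖y - u‖ ^ 2 := by
    rw [← norm_sub_sq_real, sub_sub_sub_cancel_right]
  rw [h1, h2, norm_add_sq_real, norm_smul, norm_smul, real_inner_smul_left,
    real_inner_smul_right, mul_pow, mul_pow, Real.norm_eq_abs, Real.norm_eq_abs, sq_abs, sq_abs]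
  obtain rfl := eq_sub_of_add_eq hab
  ring

/-- The quadratic term contributes the modulus `1 + A μ` and `α ψ` contributes `α μ`. -/
lemma strongConvexOn_fgmPhi {A α : ℝ} (hα : 0 ≤ α) {u : Euc n} {ψ : Euc n → ℝ}
    (hψ : StrongConvexOn Q μ ψ) : StrongConvexOn Q (1 + (A + α) * μ) (fgmPhi μ A α u ψ) := by
  refine ⟨hψ.1, fun x hx y hy a b ha hb hab => ?_⟩
  have h := mul_le_mul_of_nonneg_left (hψ.2 hx hy ha hb hab) hα
  simp only [fgmPhi, smul_eq_mul, norm_combo_sub_sq x y u hab] at h ⊢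
  linarith

lemma exists_isGreatest_root (hΛ : 0 < Λ) (hμ : 0 ≤ μ) {A : ℝ} (hA : 0 ≤ A) :
    ∃ α, 0 < α ∧ IsGreatest {a : ℝ | (A + a) * (1 + A * μ) = Λ * a ^ 2} α := by
  set b := 1 + A * μ with hb
  have hb0 : 0 < b := by positivity
  have hD : 0 ≤ b ^ 2 + 4 * Λ * (A * b) := by positivity
  set D := Real.sqrt (b ^ 2 + 4 * Λ * (A * b)) with hDd
  have hD2 : D ^ 2 = b ^ 2 + 4 * Λ * (A * b) := Real.sq_sqrt hD
  have hD0 : 0 ≤ D := Real.sqrt_nonneg _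
  refine ⟨(b + D) / (2 * Λ), by positivity, ?_, fun a ha => ?_⟩
  · simp only [mem_ofPred_eq]
    field_simp
    nlinarith
  · simp only [mem_ofPred_eq] at ha
    rw [le_div_iff₀ (by positivity)]
    have h1 : (2 * Λ * a - b) ^ 2 ≤ D ^ 2 := by rw [hD2]; nlinarith
    linarith [(abs_le_of_sq_le_sq' h1 hD0).2]

lemma pos_of_isGreatest_root (hΛ : 0 < Λ) (hμ : 0 ≤ μ) {A α : ℝ} (hA : 0 ≤ A)
    (h : IsGreatest {a : ℝ | (A + a) * (1 + A * μ) = Λ * a ^ 2} α) : 0 < α := by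
  obtain ⟨α', h0, h1⟩ := exists_isGreatest_root hΛ hμ hA
  rwa [h.unique h1]

lemma Convex.inv_add_smul_mem (hQ : Convex ℝ Q) {A α : ℝ} (hA : 0 ≤ A) (hα : 0 < α) {u y : Euc n}
    (hu : u ∈ Q) (hy : y ∈ Q) : (A + α)⁻¹ • (α • u + A • y) ∈ Q := by
  rw [smul_add, smul_smul, smul_smul]
  exact hQ hu hy (by positivity) (by positivity) (by field_simp; ring)

lemma FGMRun.exists_run (hQ : Convex ℝ Q) (hQc : IsClosed Q) (hΛ : 0 < Λ) (hμ : 0 ≤ μ)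
    (hex : ∀ z ∈ Q, ∃ ψ k, oracle z ψ k)
    (hmodel : ∀ z ∈ Q, ∀ ψ k, oracle z ψ k → IsInexactModel Q f Λ μ δ z ψ) (N : ℕ) :
    ∀ (y u : Euc n) (A : ℝ), y ∈ Q → u ∈ Q → 0 ≤ A →
      ∃ (out : Euc n) (k : OpCount), FGMRun Q Λ μ oracle N y u A out k := by
  induction N with
  | zero => exact fun y u A _ _ _ => ⟨y, _, .finish⟩
  | succ N ih =>
    intro y u A hy hu hA
    obtain ⟨α, hα, hroot⟩ := exists_isGreatest_root hΛ hμ hA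
    have hz := hQ.inv_add_smul_mem hA hα hu hy
    obtain ⟨ψ, k, hψ⟩ := hex _ hz
    have hm := hmodel _ hz ψ k hψ
    have hc : ContinuousOn (fgmPhi μ A α u ψ) Q :=
      ContinuousOn.add (by fun_prop) (hm.continuousOn.const_mul α)
    obtain ⟨u', hu', hmin⟩ := (strongConvexOn_fgmPhi hα.le hm.strongConvexOn).exists_isMinOn
      (by positivity) hc hQc hu
    obtain ⟨out, k', hrun⟩ := ih _ u' (A + α) (hQ.inv_add_smul_mem hA hα hu' hy) hu' (by positivity)
    exact ⟨out, _, .step hroot rfl hψ hu' hmin rfl hrun⟩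

lemma FGMRun.count {K : ℕ} (hcount : ∀ z ψ k, oracle z ψ k →
      k.gradX = 1 ∧ k.prox = 0 ∧ k.subgradY ≤ K ∧ k.matVec ≤ K)
    {N : ℕ} {y u out : Euc n} {A : ℝ} {k : OpCount} (h : FGMRun Q Λ μ oracle N y u A out k) :
    k.gradX = N ∧ k.prox = N ∧ k.subgradY ≤ N * K ∧ k.matVec ≤ N * K := by
  induction h with
  | finish => simp
  | step hα hz hψ hu hmin hy next ih =>
    have := hcount _ _ _ hψ
    refine ⟨?_, ?_, ?_, ?_⟩ <;> simp only [add_mul, one_mul] <;> omega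

/-- One step of the fast gradient method. -/
lemma IsInexactModel.step_le {A α : ℝ} (hA : 0 ≤ A) (hα : 0 < α) (hμ : 0 ≤ μ) {u y z u' y' : Euc n}
    {ψ : Euc n → ℝ} (hroot : (A + α) * (1 + A * μ) = Λ * α ^ 2)
    (hz : z = (A + α)⁻¹ • (α • u + A • y)) (hψ : IsInexactModel Q f Λ μ δ z ψ) (hy : y ∈ Q)
    (hu' : u' ∈ Q) (hmin : IsMinOn (fgmPhi μ A α u ψ) Q u')
    (hy' : y' = (A + α)⁻¹ • (α • u' + A • y)) {x : Euc n} (hx : x ∈ Q) :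
    (A + α) * (f y' - f x) + (1 + (A + α) * μ) / 2 * ‖u' - x‖ ^ 2 ≤
      A * (f y - f x) + (1 + A * μ) / 2 * ‖u - x‖ ^ 2 + (A + α) * δ := by
  have hAα : 0 < A + α := by positivity
  obtain ⟨fz, hlow, hup⟩ := hψ.bounds
  have hQ := hψ.strongConvexOn.1
  have hy'Q : y' ∈ Q := hy' ▸ hQ.inv_add_smul_mem hA hα hu' hy
  have h1 := hup y' hy'Q
  have h2 : (A + α) * ψ y' ≤ α * ψ u' + A * ψ y := by
    have hc : ConvexOn ℝ Q ψ := hψ.strongConvexOn.convexOn fun r => by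
      simp only [Pi.zero_apply]; positivity
    have h3 := hc.2 hu' hy (show 0 ≤ (A + α)⁻¹ * α by positivity)
      (show 0 ≤ (A + α)⁻¹ * A by positivity) (by field_simp; ring)
    rw [← smul_smul, ← smul_smul, ← smul_add, ← hy'] at h3
    have h4 := mul_le_mul_of_nonneg_left h3 hAα.le
    simp only [smul_eq_mul] at h4
    field_simp at h4
    linarith
  -- The equation for `α` is chosen so that the quadratic error of the model at `y'` equals the
  -- proximal term at `u'`; the two cancel in the final sum.
  have h3 : (A + α) * (Λ / 2 * ‖y' - z‖ ^ 2) = (1 + A * μ) / 2 * ‖u' - u‖ ^ 2 := by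
    have h4 : y' - z = ((A + α)⁻¹ * α) • (u' - u) := by
      rw [hy', hz]
      module
    rw [h4, norm_smul, Real.norm_of_nonneg (by positivity)]
    have h5 : 1 + A * μ = Λ * α ^ 2 / (A + α) := by rw [← hroot]; field_simp
    rw [h5]
    field_simp
  have h4 := (strongConvexOn_fgmPhi hα.le hψ.strongConvexOn).add_sq_le_of_isMinOn hu' hmin hx
  simp only [fgmPhi] at h4
  have h5 := mul_le_mul_of_nonneg_left (hlow y hy) hA
  have h6 := mul_le_mul_of_nonneg_left (hlow x hx) hα.le
  have h7 := mul_le_mul_of_nonneg_left h1 hAα.le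
  rw [norm_sub_rev x u', norm_sub_rev x u] at h4
  linarith

/-- The rate of the fast gradient method. -/
def fgmRate (Λ μ : ℝ) : ℝ := 1 / (1 + Real.sqrt (Λ / μ))

lemma fgmRate_pos (Λ μ : ℝ) : 0 < fgmRate Λ μ := by unfold fgmRate; positivity

lemma fgmRate_le_one (Λ μ : ℝ) : fgmRate Λ μ ≤ 1 := by
  unfold fgmRate
  rw [div_le_one (by positivity)]
  linarith [Real.sqrt_nonneg (Λ / μ)]

/-- The root equation gives `μ A² ≤ Λ α²`, so `A ≤ √(Λ/μ) α`; now add `α`. -/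
lemma fgmRate_mul_le (hΛ : 0 < Λ) (hμ : 0 < μ) {A α : ℝ} (hA : 0 ≤ A) (hα : 0 < α)
    (hroot : (A + α) * (1 + A * μ) = Λ * α ^ 2) : fgmRate Λ μ * (A + α) ≤ α := by
  have h1 : A ≤ Real.sqrt (Λ / μ) * α := by
    refine abs_le_of_sq_le_sq' ?_ (by positivity) |>.2
    rw [mul_pow, Real.sq_sqrt (by positivity), div_mul_eq_mul_div, ← hroot, le_div_iff₀ hμ]
    nlinarith [mul_nonneg hA hμ.le, mul_nonneg hA hα.le, mul_nonneg (mul_nonneg hA hμ.le) hα.le]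
  unfold fgmRate
  rw [div_mul_eq_mul_div, div_le_iff₀ (by positivity)]
  linarith

/-- The convergence of the fast gradient method with an inexact model. -/
lemma FGMRun.bound (hQ : Convex ℝ Q) (hΛ : 0 < Λ) (hμ : 0 < μ) (hδ : 0 ≤ δ)
    (hmodel : ∀ z ∈ Q, ∀ ψ k, oracle z ψ k → IsInexactModel Q f Λ μ δ z ψ) {x : Euc n}
    (hx : x ∈ Q) {N : ℕ} {y u out : Euc n} {A : ℝ} {k : OpCount}
    (h : FGMRun Q Λ μ oracle N y u A out k) (hA : 0 ≤ A) (hy : y ∈ Q) (hu : u ∈ Q) :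
    out ∈ Q ∧ ∃ A', A ≤ A' * (1 - fgmRate Λ μ) ^ N ∧
      (0 < N → 1 ≤ Λ * (A' * (1 - fgmRate Λ μ) ^ (N - 1))) ∧
      A' * (f out - f x) ≤ A * (f y - f x) + (1 + A * μ) / 2 * ‖u - x‖ ^ 2
        + δ / fgmRate Λ μ * (A' - A) := by
  have hθ := fgmRate_pos Λ μ
  have hθ1 := fgmRate_le_one Λ μ
  set θ := fgmRate Λ μ
  induction h with
  | @finish y u A =>
    refine ⟨hy, A, by simp, by simp, ?_⟩
    have : 0 ≤ (1 + A * μ) / 2 * ‖u - x‖ ^ 2 := by positivity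
    simp only [sub_self, mul_zero, add_zero]
    linarith
  | @step N y u z u' y' out A α ψ k₁ k₂ hα hz hψ hu' hmin hy' next ih =>
    have hα0 := pos_of_isGreatest_root hΛ hμ.le hA hα
    have hroot : (A + α) * (1 + A * μ) = Λ * α ^ 2 := hα.1
    have hzQ : z ∈ Q := hz ▸ hQ.inv_add_smul_mem hA hα0 hu hy
    have hy'Q : y' ∈ Q := hy' ▸ hQ.inv_add_smul_mem hA hα0 hu' hy
    have hθα := fgmRate_mul_le hΛ hμ hA hα0 hroot
    obtain ⟨hout, A', h1, -, h3⟩ := ih (by positivity) hy'Q hu'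
    refine ⟨hout, A', ?_, fun _ => ?_, ?_⟩
    · have := mul_le_mul_of_nonneg_right h1 (sub_nonneg.2 hθ1)
      rw [pow_succ, ← mul_assoc]
      linarith
    -- The first step only guarantees `A + α ≥ 1/Λ`; geometric growth is used for the other `N - 1`.
    · have h4 : A + α ≤ Λ * (A + α) * (A + α) := by
        have : 0 ≤ (A + α) * (A * μ) := by positivity
        have : 0 ≤ Λ * (A * (A + α) + A * α) := by positivity
        nlinarith
      have h5 : 1 ≤ Λ * (A + α) := by
        by_contra hlt
        push Not at hlt
        nlinarith
      rw [Nat.add_sub_cancel]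
      exact h5.trans (mul_le_mul_of_nonneg_left h1 hΛ.le)
    · have h4 := (hmodel z hzQ ψ k₁ hψ).step_le hA hα0 hμ.le hroot hz hy hu' hmin hy' hx
      -- The model error of the step is charged to the increment `α` of `A` at the price `δ/θ`, so
      -- the errors telescope.
      have h5 : (A + α) * δ ≤ δ / θ * α := by
        rw [div_mul_eq_mul_div, le_div_iff₀ hθ]
        have := mul_le_mul_of_nonneg_left hθα hδ
        linarith
      linarith

end FastGradientMethod

end

noncomputable section

/-! ### The saddle-point problem as an inexact-model problem. -/

section SaddleProblem

variable {n m : ℕ} {Qx : Set (Euc n)} {Qy : Set (Euc m)} {r : Euc n → ℝ} {F : Euc n → Euc m → ℝ}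
  {c : Euc m} {Lxx Lxy μx μy B ℛ ρ : ℝ}

namespace IsSaddleProblem

lemma nonempty_Qy (hP : IsSaddleProblem Qx Qy r F c Lxx Lxy μx μy B ℛ ρ) (hρ : 0 ≤ ρ) :
    Qy.Nonempty := by
  obtain ⟨p, hp⟩ := hP.ball_subset
  exact ⟨p, hp (Metric.mem_closedBall_self hρ)⟩

/-- The inner maximum is attained. -/
lemma exists_max (hP : IsSaddleProblem Qx Qy r F c Lxx Lxy μx μy B ℛ ρ) (hρ : 0 ≤ ρ) {x : Euc n}
    (hx : x ∈ Qx) : ∃ y ∈ Qy, IsMaxOn (F x) Qy y ∧ innerMax Qy F x = F x y := by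
  obtain ⟨y, hy, hmax⟩ := hP.compact_Qy.exists_isMaxOn (hP.nonempty_Qy hρ) (f := F x)
    fun y hy => (hP.diff_y x hx y hy).continuousAt.continuousWithinAt
  refine ⟨y, hy, hmax, IsGreatest.csSup_eq ⟨mem_image_of_mem _ hy, ?_⟩⟩
  rintro _ ⟨y', hy', rfl⟩
  exact hmax hy'

lemma le_innerMax (hP : IsSaddleProblem Qx Qy r F c Lxx Lxy μx μy B ℛ ρ) (hρ : 0 ≤ ρ) {x : Euc n}
    (hx : x ∈ Qx) {y : Euc m} (hy : y ∈ Qy) : F x y ≤ innerMax Qy F x := by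
  obtain ⟨y', -, hmax, h⟩ := hP.exists_max hρ hx
  exact h ▸ hmax hy

/-- Fix the maximizer `y` at the intermediate point: `F(·, y)` is convex and lies below `s` at the
endpoints. The modulus comes from `r`. -/
lemma strongConvexOn_outerObj (hP : IsSaddleProblem Qx Qy r F c Lxx Lxy μx μy B ℛ ρ)
    (hρ : 0 ≤ ρ) : StrongConvexOn Qx μx (outerObj Qy r F) := by
  refine ⟨hP.convex_Qx, fun x hx x' hx' a b ha hb hab => ?_⟩
  have h1 := hP.strongConvex_r.2 hx hx' ha hb hab
  obtain ⟨y, hy, -, h⟩ := hP.exists_max hρ (hP.convex_Qx hx hx' ha hb hab)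
  have h2 := (hP.convex_F y hy).2 hx hx' ha hb hab
  have h3 := mul_le_mul_of_nonneg_left (hP.le_innerMax hρ hx hy) ha
  have h4 := mul_le_mul_of_nonneg_left (hP.le_innerMax hρ hx' hy) hb
  simp only [outerObj, smul_eq_mul] at h1 h2 ⊢
  rw [h]
  linarith

lemma convexOn_neg (hP : IsSaddleProblem Qx Qy r F c Lxx Lxy μx μy B ℛ ρ) (hμy : 0 ≤ μy)
    {x : Euc n} (hx : x ∈ Qx) : ConvexOn ℝ Qy fun y => -F x y :=
  ((hP.strongConcave_F x hx).concaveOn fun r => by simp only [Pi.zero_apply]; positivity).neg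

lemma deltaSubdiff_nonempty (hP : IsSaddleProblem Qx Qy r F c Lxx Lxy μx μy B ℛ ρ) (hμy : 0 ≤ μy)
    {x : Euc n} (hx : x ∈ Qx) {y : Euc m} (hy : y ∈ Qy) :
    (deltaSubdiff 0 Qy (fun q => -F x q) y).Nonempty := by
  refine ⟨gradient (fun q => -F x q) y, fun y' hy' => ?_⟩
  have hd : DifferentiableAt ℝ (fun q => -F x q) y := (hP.diff_y x hx y hy).neg
  have := (hP.convexOn_neg hμy hx).add_inner_le hd.hasGradientAt hy hy'
  linarith

/-- The quadratic growth of `-F x` away from the maximizer. -/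
lemma add_sq_le_of_isMaxOn (hP : IsSaddleProblem Qx Qy r F c Lxx Lxy μx μy B ℛ ρ) {x : Euc n}
    (hx : x ∈ Qx) {y y' : Euc m} (hy : y ∈ Qy) (hmax : IsMaxOn (F x) Qy y) (hy' : y' ∈ Qy) :
    F x y' + μy / 2 * ‖y' - y‖ ^ 2 ≤ F x y := by
  have h : StrongConvexOn Qy μy (-F x) := UniformConcaveOn.neg (hP.strongConcave_F x hx)
  have := h.add_sq_le_of_isMinOn hy hmax.neg hy'
  simp only [Pi.neg_apply] at this
  linarith

/-- An approximate inner maximizer gives an inexact model of the outer objective. -/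
lemma isInexactModel (hP : IsSaddleProblem Qx Qy r F c Lxx Lxy μx μy B ℛ ρ) (hρ : 0 ≤ ρ)
    (hLxx : 0 ≤ Lxx) (hμy : 0 < μy) {δ : ℝ} {z : Euc n} (hz : z ∈ Qx) {y : Euc m} (hy : y ∈ Qy)
    (hδ : innerMax Qy F z - F z y ≤ δ) :
    IsInexactModel Qx (outerObj Qy r F) (2 * effL Lxx Lxy μy) μx (2 * δ) z
      (fun x => r x - r z + inner ℝ (gradient (fun p => F p y) z) (x - z)) := by
  set g := gradient (fun p => F p y) z with hg
  have hdiff : ∀ y ∈ Qy, ∀ x ∈ Qx, DifferentiableAt ℝ (fun p => F p y) x := fun y hy x hx =>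
    hP.diff_x x hx y hy
  refine ⟨(hP.continuous_r.sub continuousOn_const).add (by fun_prop),
    ⟨hP.convex_Qx, fun x hx x' hx' a b ha hb hab => ?_⟩, r z + F z y, fun x hx => ?_,
    fun x hx => ?_⟩
  · have h1 := hP.strongConvex_r.2 hx hx' ha hb hab
    have h2 : a • x + b • x' - z = a • (x - z) + b • (x' - z) := by
      obtain rfl := eq_sub_of_add_eq hab
      module
    obtain rfl := eq_sub_of_add_eq hab
    simp only [smul_eq_mul, h2, inner_add_right, real_inner_smul_right] at h1 ⊢
    linarith
  · have h1 := (hP.convex_F y hy).add_inner_le (hdiff y hy z hz).hasGradientAt hz hx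
    have h2 := hP.le_innerMax hρ hx hy
    simp only [outerObj]
    linarith
  · obtain ⟨yx, hyx, -, hsx⟩ := hP.exists_max hρ hx
    obtain ⟨ys, hys, hmax, hsz⟩ := hP.exists_max hρ hz
    have h1 := hP.convex_Qx.le_add_inner_add_sq (hdiff yx hyx)
      (fun x hx x' hx' => hP.lip_xx x hx x' hx' yx hyx) hz hx
    have h2 : inner ℝ (gradient (fun p => F p yx) z) (x - z) ≤
        inner ℝ g (x - z) + Lxy * ‖yx - y‖ * ‖x - z‖ := by
      have h3 := real_inner_le_norm (gradient (fun p => F p yx) z - g) (x - z)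
      have h4 := mul_le_mul_of_nonneg_right (hP.lip_xy z hz yx hyx y hy) (norm_nonneg (x - z))
      rw [inner_sub_left] at h3
      linarith
    have h5 := hP.add_sq_le_of_isMaxOn hz hys hmax hyx
    have h6 := hP.add_sq_le_of_isMaxOn hz hys hmax hy
    have h7 : ‖yx - y‖ ≤ ‖yx - ys‖ + ‖y - ys‖ := by
      rw [norm_sub_rev y ys]
      exact norm_sub_le_norm_sub_add_norm_sub _ _ _
    -- Pass through the exact maximizer `ys` and apply Young's inequality twice. Quadratic growth
    -- cancels the `yx` term and bounds the `y` term by `δ`; the other `δ` is the gap `s(z) - F(z,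
    -- y)`.
    have h8 : Lxy * ‖yx - y‖ * ‖x - z‖ ≤
        μy / 2 * ‖yx - ys‖ ^ 2 + μy / 2 * ‖y - ys‖ ^ 2 + Lxy ^ 2 / μy * ‖x - z‖ ^ 2 := by
      have h9 : |Lxy| * ‖yx - y‖ * ‖x - z‖ ≤ |Lxy| * (‖yx - ys‖ + ‖y - ys‖) * ‖x - z‖ := by gcongr
      have h10 : Lxy * ‖yx - y‖ * ‖x - z‖ ≤ |Lxy| * ‖yx - y‖ * ‖x - z‖ := by
        gcongr
        exact le_abs_self _
      have h11 : ∀ t : ℝ, |Lxy| * t * ‖x - z‖ ≤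
          μy / 2 * t ^ 2 + Lxy ^ 2 / μy / 2 * ‖x - z‖ ^ 2 := by
        intro t
        have h12 := sq_nonneg (μy * t - |Lxy| * ‖x - z‖)
        rw [sub_sq, mul_pow, mul_pow, sq_abs] at h12
        have h13 : μy / 2 * t ^ 2 + Lxy ^ 2 / μy / 2 * ‖x - z‖ ^ 2 - |Lxy| * t * ‖x - z‖
            = (μy ^ 2 * t ^ 2 - 2 * (μy * t) * (|Lxy| * ‖x - z‖) + Lxy ^ 2 * ‖x - z‖ ^ 2)
              / (2 * μy) := by
          field_simp
          ring
        have := div_nonneg h12 (by positivity : 0 ≤ 2 * μy)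
        linarith
      linarith [h11 ‖yx - ys‖, h11 ‖y - ys‖]
    have h14 : 2 * effL Lxx Lxy μy / 2 * ‖x - z‖ ^ 2 =
        Lxx * ‖x - z‖ ^ 2 + 2 * (Lxy ^ 2 / μy * ‖x - z‖ ^ 2) := by
      unfold effL; ring
    have h15 : 0 ≤ Lxx * ‖x - z‖ ^ 2 := by positivity
    have h16 : 0 ≤ Lxy ^ 2 / μy * ‖x - z‖ ^ 2 := by positivity
    simp only [outerObj, h14]
    linarith

end IsSaddleProblem

/-- The feasibility, accuracy and cost of the whole method with `N` outer iterations and inner accuracy `δ`. -/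
lemma ApproachTwo.exists_run_and_bound (hm : 1 ≤ m) (hLxx : 0 ≤ Lxx) (hμx : 0 < μx)
    (hμy : 0 < μy) (hB : 0 < B) (hℛ : 0 < ℛ) (hρ : 0 < ρ) (hL : 0 < effL Lxx Lxy μy) {δ R : ℝ}
    (hδ : 0 < δ) {N : ℕ} (hN : 0 < N)
    (hP : IsSaddleProblem Qx Qy r F c Lxx Lxy μx μy B ℛ ρ) {x₀ xs : Euc n} (hx₀ : x₀ ∈ Qx)
    (hxs : xs ∈ Qx) (hmin : IsMinOn (outerObj Qy r F) Qx xs) (hR : ‖x₀ - xs‖ ≤ R) :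
    let K := ellipsoidSteps m ℛ (min 1 (δ / B) * ρ)
    let θ := fgmRate (2 * effL Lxx Lxy μy) μx
    (∃ (out : Euc n) (k : OpCount), ApproachTwo Qx Qy r F c Lxx Lxy μx μy ℛ N K x₀ out k) ∧
      ∀ (out : Euc n) (k : OpCount), ApproachTwo Qx Qy r F c Lxx Lxy μx μy ℛ N K x₀ out k →
        out ∈ Qx ∧
        μx / 2 * ‖out - xs‖ ^ 2 ≤ effL Lxx Lxy μy * R ^ 2 * (1 - θ) ^ (N - 1) + 2 * δ / θ ∧
        k.gradX = N ∧ k.prox = N ∧ k.subgradY ≤ N * K ∧ k.matVec ≤ N * K := by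
  intro K θ
  obtain ⟨p, hp⟩ := hP.ball_subset
  -- The ellipsoid method with contraction `τ` has error `τ B ≤ δ`; the cap at 1 keeps the
  -- contracted ball inside `Q_y`.
  have hτ : 0 < min 1 (δ / B) := by positivity
  have hex : ∀ z ∈ Qx, ∃ ψ k, innerOracle Qy r F c ℛ K z ψ k := fun z hz => by
    obtain ⟨y, s, t, h⟩ := EllipsoidMethod.exists_run hm hP.convex_Qy hP.compact_Qy.isClosed
      (mul_pos hτ hρ) (mul_le_of_le_one_left hρ.le (min_le_left _ _)) hℛ hp hP.subset_ball
      fun y hy => hP.deltaSubdiff_nonempty hμy.le hz hy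
    exact ⟨_, _, y, s, t, h, rfl, rfl⟩
  have hmodel : ∀ z ∈ Qx, ∀ ψ k, innerOracle Qy r F c ℛ K z ψ k →
      IsInexactModel Qx (outerObj Qy r F) (2 * effL Lxx Lxy μy) μx (2 * δ) z ψ := by
    rintro z hz ψ k ⟨y, s, t, h, rfl, rfl⟩
    obtain ⟨ys, hys, -, hsz⟩ := hP.exists_max hρ.le hz
    obtain ⟨hy, hle⟩ := EllipsoidMethod.mem_and_le (B := B) hm (hP.convexOn_neg hμy.le hz) hτ
      (min_le_left _ _) hρ hℛ hp hP.subset_ball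
      (fun y hy y' hy' => by linarith [hP.bounded z hz y' hy' y hy]) h hys
    refine hP.isInexactModel hρ.le hLxx hμy hz hy ?_
    have : min 1 (δ / B) * B ≤ δ := by
      calc min 1 (δ / B) * B ≤ δ / B * B := by gcongr; exact min_le_right _ _
        _ = δ := by field_simp
    linarith
  have hcount : ∀ z ψ k, innerOracle Qy r F c ℛ K z ψ k →
      k.gradX = 1 ∧ k.prox = 0 ∧ k.subgradY ≤ K ∧ k.matVec ≤ K := by
    rintro z ψ k ⟨y, s, t, h, rfl, rfl⟩
    exact ⟨rfl, rfl, EllipsoidRun.count_le h⟩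
  refine ⟨FGMRun.exists_run hP.convex_Qx hP.closed_Qx (by positivity) hμx.le hex hmodel N x₀ x₀ 0
    hx₀ hx₀ le_rfl, fun out k h => ?_⟩
  obtain ⟨hout, A', -, hA', hbd⟩ := FGMRun.bound hP.convex_Qx (by positivity) hμx (by positivity)
    hmodel hxs h le_rfl hx₀ hx₀
  refine ⟨hout, ?_, FGMRun.count hcount h⟩
  have hgrow := (hP.strongConvexOn_outerObj hρ.le).add_sq_le_of_isMinOn hxs hmin hout
  have hθ1 : 0 ≤ (1 - θ) ^ (N - 1) := pow_nonneg (sub_nonneg.2 (fgmRate_le_one _ _)) _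
  have h1 := hA' hN
  have hA'0 : 0 < A' := by
    by_contra hneg
    push Not at hneg
    have : 2 * effL Lxx Lxy μy * (A' * (1 - θ) ^ (N - 1)) ≤ 0 :=
      mul_nonpos_of_nonneg_of_nonpos (by positivity) (mul_nonpos_of_nonpos_of_nonneg hneg hθ1)
    linarith
  have h2 : ‖x₀ - xs‖ ^ 2 ≤ R ^ 2 := by gcongr
  -- This bounds the initial potential by a multiple of `A'`, which can then be divided out.
  have h3 : R ^ 2 / 2 ≤ A' * (effL Lxx Lxy μy * R ^ 2 * (1 - θ) ^ (N - 1)) := by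
    have := mul_le_mul_of_nonneg_right h1 (by positivity : 0 ≤ R ^ 2 / 2)
    linarith
  have h4 : A' * (outerObj Qy r F out - outerObj Qy r F xs) ≤
      A' * (effL Lxx Lxy μy * R ^ 2 * (1 - θ) ^ (N - 1) + 2 * δ / θ) := by
    simp only [zero_mul, add_zero, sub_zero, zero_add] at hbd
    linarith
  have h5 := le_of_mul_le_mul_left h4 hA'0
  linarith

end SaddleProblem

/-! ### Iteration counts and the choice of parameters. -/

section Complexity

/-- The number of outer iterations for accuracy `ε`, where `ℓ = log (L R² / (μ ε²))`. -/
def outerSteps (θ ℓ : ℝ) : ℕ := ⌈(Real.log 4 + ℓ) / θ⌉₊ + 1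

/-- From `1 - θ ≤ exp(-θ)`. The `log 4` yields the factor `1/4`, and the `+ 1` in `outerSteps` pays
for the exponent `N - 1`. -/
lemma pow_outerSteps_le {θ ℓ : ℝ} (hθ : 0 < θ) (hθ1 : θ ≤ 1) :
    (1 - θ) ^ (outerSteps θ ℓ - 1) ≤ Real.exp (-ℓ) / 4 := by
  rw [outerSteps, Nat.add_sub_cancel]
  calc (1 - θ) ^ ⌈(Real.log 4 + ℓ) / θ⌉₊ ≤ Real.exp (-θ) ^ ⌈(Real.log 4 + ℓ) / θ⌉₊ := by
        refine pow_le_pow_left₀ (by linarith) ?_ _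
        linarith [Real.add_one_le_exp (-θ)]
    _ = Real.exp (⌈(Real.log 4 + ℓ) / θ⌉₊ * -θ) := (Real.exp_nat_mul _ _).symm
    _ ≤ Real.exp (-ℓ - Real.log 4) := by
        apply Real.exp_le_exp.2
        have := (div_le_iff₀ hθ).1 (Nat.le_ceil ((Real.log 4 + ℓ) / θ))
        linarith
    _ = Real.exp (-ℓ) / 4 := by rw [Real.exp_sub, Real.exp_log (by norm_num)]

/-- The factors are at most `12/5 · M` (as `log 4 ≤ 7/5`) and `5/2 · S` (as `√2 ≤ 3/2`). Their
product gives 6, and the ceiling and the `+ 1` add 2. -/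
lemma outerSteps_le {L μ : ℝ} (hL : 0 < L) (hμ : 0 < μ) (ℓ : ℝ) :
    (outerSteps (fgmRate (2 * L) μ) ℓ : ℝ) ≤ 8 * (Real.sqrt (max 1 (L / μ)) * max 1 ℓ) := by
  set S := Real.sqrt (max 1 (L / μ)) with hS
  set M := max 1 ℓ with hM
  have hS1 : 1 ≤ S := Real.one_le_sqrt.2 (le_max_left _ _)
  have hM1 : 1 ≤ M := le_max_left _ _
  have hκ : Real.sqrt (2 * L / μ) ≤ 3 / 2 * S := by
    rw [Real.sqrt_le_left (by positivity), mul_pow, Real.sq_sqrt (by positivity), mul_div_assoc]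
    have : L / μ ≤ max 1 (L / μ) := le_max_right _ _
    have : 0 < L / μ := by positivity
    linarith
  have hlog : Real.log 4 ≤ 7 / 5 := by
    have : (4 : ℝ) = 2 ^ 2 := by norm_num
    rw [this, Real.log_pow]
    push_cast
    linarith [Real.log_two_lt_d9]
  have h1 : (Real.log 4 + ℓ) / fgmRate (2 * L) μ ≤ 6 * (S * M) := by
    rw [fgmRate, div_div_eq_mul_div, div_one]
    calc (Real.log 4 + ℓ) * (1 + Real.sqrt (2 * L / μ)) ≤ (12 / 5 * M) * (5 / 2 * S) := by
          gcongr
          · linarith [le_max_right 1 ℓ]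
          · linarith
      _ = 6 * (S * M) := by ring
  have h2 : (⌈(Real.log 4 + ℓ) / fgmRate (2 * L) μ⌉₊ : ℝ) ≤ 6 * (S * M) + 1 :=
    (Nat.cast_le.2 (Nat.ceil_mono h1)).trans (Nat.ceil_lt_add_one (by positivity)).le
  have h3 : 1 ≤ S * M := one_le_mul_of_one_le_of_one_le hS1 hM1
  rw [outerSteps]
  push_cast
  linarith

/-- Applied with `X = Bℛ/(ρε)`. The cube costs a factor 3, `m + 1 ≤ 2m` makes it 12, and the `+ 1`
makes it 13. -/
lemma ellipsoidSteps_le {m : ℕ} (hm : 1 ≤ m) {ℛ a X : ℝ} (hℛ : 0 < ℛ) (ha : 0 < a)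
    (hX : 1 ≤ Real.log X) (h : ℛ / a ≤ X ^ 3) :
    (ellipsoidSteps m ℛ a : ℝ) ≤ 13 * ((m : ℝ) ^ 2 * Real.log X) := by
  have hm' : (1 : ℝ) ≤ m := by exact_mod_cast hm
  have h1 : Real.log (ℛ / a) ≤ 3 * Real.log X := by
    have := Real.log_le_log (by positivity) h
    rwa [Real.log_pow] at this
  have h2 : 2 * m * (m + 1) * Real.log (ℛ / a) ≤ 12 * ((m : ℝ) ^ 2 * Real.log X) := by
    calc 2 * m * (m + 1) * Real.log (ℛ / a) ≤ 2 * m * (m + 1) * (3 * Real.log X) := by gcongr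
      _ ≤ 2 * m * (m + m) * (3 * Real.log X) := by gcongr
      _ = _ := by ring
  have h3 : (⌊2 * m * (m + 1) * Real.log (ℛ / a)⌋₊ : ℝ) ≤ 12 * ((m : ℝ) ^ 2 * Real.log X) :=
    (Nat.cast_le.2 (Nat.floor_mono h2)).trans (Nat.floor_le (by positivity))
  have h4 : 1 ≤ (m : ℝ) ^ 2 * Real.log X := one_le_mul_of_one_le_of_one_le (one_le_pow₀ hm') hX
  rw [ellipsoidSteps]
  push_cast
  linarith

end Complexity

theorem mainTheorem2 :
    ∃ C : ℝ, 0 < C ∧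
      ∀ (m : ℕ) (Lxx Lxy μx μy B ℛ ρ R : ℝ),
        1 ≤ m → 0 ≤ Lxx → 0 ≤ Lxy → 0 < μx → 0 < μy → 0 < B → 0 < ℛ → 0 < ρ → 0 < R →
        0 < effL Lxx Lxy μy →
        ∃ ε₀ : ℝ, 0 < ε₀ ∧ ∀ ε : ℝ, 0 < ε → ∃ N K : ℕ,
          ∀ (n : ℕ) (Qx : Set (Euc n)) (Qy : Set (Euc m)) (r : Euc n → ℝ)
            (F : Euc n → Euc m → ℝ) (c : Euc m) (x₀ xs : Euc n),
            IsSaddleProblem Qx Qy r F c Lxx Lxy μx μy B ℛ ρ →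
            x₀ ∈ Qx → xs ∈ Qx → IsMinOn (outerObj Qy r F) Qx xs → ‖x₀ - xs‖ ≤ R →
            (∃ (out : Euc n) (k : OpCount),
              ApproachTwo Qx Qy r F c Lxx Lxy μx μy ℛ N K x₀ out k) ∧
            ∀ (out : Euc n) (k : OpCount),
              ApproachTwo Qx Qy r F c Lxx Lxy μx μy ℛ N K x₀ out k →
              out ∈ Qx ∧ ‖out - xs‖ ≤ ε ∧
              (k.gradX : ℝ) ≤ C * (Real.sqrt (max 1 (effL Lxx Lxy μy / μx)) *
                max 1 (Real.log (effL Lxx Lxy μy * R ^ 2 / (μx * ε ^ 2)))) ∧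
              (k.prox : ℝ) ≤ C * (Real.sqrt (max 1 (effL Lxx Lxy μy / μx)) *
                max 1 (Real.log (effL Lxx Lxy μy * R ^ 2 / (μx * ε ^ 2)))) ∧
              (ε ≤ ε₀ →
                (k.subgradY : ℝ) ≤ C * ((m : ℝ) ^ 2 *
                  Real.sqrt (max 1 (effL Lxx Lxy μy / μx)) *
                  Real.log (effL Lxx Lxy μy * R ^ 2 / (μx * ε ^ 2)) *
                  Real.log (B * ℛ / (ρ * ε))) ∧
                (k.matVec : ℝ) ≤ C * ((m : ℝ) ^ 2 *
                  Real.sqrt (max 1 (effL Lxx Lxy μy / μx)) *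
                  Real.log (effL Lxx Lxy μy * R ^ 2 / (μx * ε ^ 2)) *
                  Real.log (B * ℛ / (ρ * ε)))) := by
  -- `104 = 8 · 13`, the product of the constants of `outerSteps_le` and `ellipsoidSteps_le`.
  refine ⟨104, by norm_num, fun m Lxx Lxy μx μy B ℛ ρ R hm hLxx _ hμx hμy hB hℛ hρ hR hL => ?_⟩
  set L := effL Lxx Lxy μy with hLdef
  set θ := fgmRate (2 * L) μx with hθdef
  have hθ : 0 < θ := fgmRate_pos _ _
  have hθ1 : θ ≤ 1 := fgmRate_le_one _ _
  -- In order, the thresholds ensure `ℓ ≥ 1` (its argument is at least `3 > e`), `δ ≤ B`, `log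
  -- (Bℛ/(ρε)) ≥ 1`, and the cubic bound required by `ellipsoidSteps_le`.
  refine ⟨min (min (Real.sqrt (L * R ^ 2 / (3 * μx))) (Real.sqrt (8 * B / (μx * θ))))
    (min (B * ℛ / (3 * ρ)) ((B * ℛ / ρ) ^ 2 * (μx * θ / 8))), by positivity, fun ε hε => ?_⟩
  set ℓ := Real.log (L * R ^ 2 / (μx * ε ^ 2)) with hℓ
  -- Chosen so that `2δ/θ = μ_x ε² / 4`, half of the allowed gap in `f`; the outer iterations use
  -- the other half.
  set δ := μx * ε ^ 2 * θ / 8 with hδdef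
  have hδ : 0 < δ := by positivity
  set N := outerSteps θ ℓ with hN
  set K := ellipsoidSteps m ℛ (min 1 (δ / B) * ρ) with hK
  have hNle := outerSteps_le hL hμx ℓ
  have hsmall : ε ≤ min (min (Real.sqrt (L * R ^ 2 / (3 * μx))) (Real.sqrt (8 * B / (μx * θ))))
      (min (B * ℛ / (3 * ρ)) ((B * ℛ / ρ) ^ 2 * (μx * θ / 8))) →
      ((N * K : ℕ) : ℝ) ≤ 104 * ((m : ℝ) ^ 2 * Real.sqrt (max 1 (L / μx)) * ℓ *
        Real.log (B * ℛ / (ρ * ε))) := by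
    intro h
    obtain ⟨⟨h1, h2⟩, h3, h4⟩ := (le_min_iff.1 h).imp le_min_iff.1 le_min_iff.1
    have he : ∀ x : ℝ, 3 ≤ x → 1 ≤ Real.log x := fun x hx =>
      (Real.le_log_iff_exp_le (by linarith)).2 (by linarith [Real.exp_one_lt_d9])
    have hℓ1 : 1 ≤ ℓ := by
      refine he _ ?_
      have := (Real.le_sqrt hε.le (by positivity)).1 h1
      rw [le_div_iff₀ (by positivity)] at this ⊢
      linarith
    have hδB : δ ≤ B := by
      have := (Real.le_sqrt hε.le (by positivity)).1 h2
      rw [le_div_iff₀ (by positivity)] at this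
      rw [hδdef]
      linarith
    have hX1 : 1 ≤ Real.log (B * ℛ / (ρ * ε)) := by
      refine he _ ?_
      rw [le_div_iff₀ (by positivity)] at h3 ⊢
      linarith
    have hK' : (K : ℝ) ≤ 13 * ((m : ℝ) ^ 2 * Real.log (B * ℛ / (ρ * ε))) := by
      refine ellipsoidSteps_le hm hℛ (by positivity) hX1 ?_
      rw [min_eq_right ((div_le_one hB).2 hδB)]
      -- This ratio is of order `ε⁻²`, so for small `ε` it is dominated by `X³`, of order `ε⁻³`.
      have e1 : ℛ / (δ / B * ρ) = B * ℛ / (ρ * ε) * (ε * (8 / (μx * θ)) / ε ^ 2) := by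
        rw [hδdef]; field_simp
      have e2 : (B * ℛ / (ρ * ε)) ^ 3 = B * ℛ / (ρ * ε) * ((B * ℛ / ρ) ^ 2 / ε ^ 2) := by
        field_simp
      rw [e1, e2]
      gcongr
      calc ε * (8 / (μx * θ)) ≤ (B * ℛ / ρ) ^ 2 * (μx * θ / 8) * (8 / (μx * θ)) := by gcongr
        _ = (B * ℛ / ρ) ^ 2 := by field_simp
    rw [max_eq_right hℓ1] at hNle
    push_cast
    calc (N : ℝ) * K ≤ 8 * (Real.sqrt (max 1 (L / μx)) * ℓ) *
          (13 * ((m : ℝ) ^ 2 * Real.log (B * ℛ / (ρ * ε)))) := by gcongr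
      _ = _ := by ring
  refine ⟨N, K, fun n Qx Qy r F c x₀ xs hP hx₀ hxs hmin hR' => ?_⟩
  have hN0 : 0 < N := Nat.succ_pos _
  obtain ⟨hex, hall⟩ := ApproachTwo.exists_run_and_bound hm hLxx hμx hμy hB hℛ hρ hL hδ hN0
    hP hx₀ hxs hmin hR'
  refine ⟨hex, fun out k h => ?_⟩
  obtain ⟨hout, hdist, h1, h2, h3, h4⟩ := hall out k h
  have hN104 : (N : ℝ) ≤ 104 * (Real.sqrt (max 1 (L / μx)) * max 1 ℓ) :=
    hNle.trans (by gcongr; norm_num)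
  refine ⟨hout, ?_, by rw [h1]; exact hN104, by rw [h2]; exact hN104, fun hε₀ =>
    ⟨(Nat.cast_le.2 h3).trans (hsmall hε₀), (Nat.cast_le.2 h4).trans (hsmall hε₀)⟩⟩
  have h5 : L * R ^ 2 * (1 - θ) ^ (N - 1) ≤ μx * ε ^ 2 / 4 := by
    calc L * R ^ 2 * (1 - θ) ^ (N - 1) ≤ L * R ^ 2 * (Real.exp (-ℓ) / 4) := by
          gcongr
          exact pow_outerSteps_le hθ hθ1
      _ = μx * ε ^ 2 / 4 := by
          rw [hℓ, Real.exp_neg, Real.exp_log (by positivity)]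
          field_simp
  have h6 : 2 * δ / θ = μx * ε ^ 2 / 4 := by
    rw [hδdef]; field_simp; ring
  rw [← hθdef, h6] at hdist
  have h7 : μx / 2 * ‖out - xs‖ ^ 2 ≤ μx / 2 * ε ^ 2 := by linarith
  exact (abs_le_of_sq_le_sq' (le_of_mul_le_mul_left h7 (by positivity)) hε.le).2
end
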